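/- All graphs are finite and loopless, and may have parallel edges; $n$ and $m$ denote the numbers of vertices and edges of a graph. A connected graph with $n\ge 4$ is \emph{matching covered} if each of its edges belongs to a perfect matching, and a matching covered graph is \emph{minimal} if the deletion of any one of its edges leaves a graph that is not matching covered. Let $\mathcal{H}$ be the class of minimal bipartite matching covered graphs, let $\mathcal{H}_0$ be the class of those members of $\mathcal{H}$ that have exactly $m-n+2$ edges both of whose ends have degree $2$, and let $\mathcal{H}_2$ be the class of those members of $\mathcal{H}$ that have exactly $2(m-n+2)$ vertices of degree $2$. A \emph{restricted bicontraction} of a graph is the contraction of the two edges $vv_1$ and $vv_2$ at a vertex $v$ of degree $2$ that has two distinct neighbours $v_1,v_2$, each of degree at least $3$ (the two edges are deleted, $v,v_1,v_2$ are identified, and all other edges are kept; an edge joining $v_1$ and $v_2$, which exists only if the graph is not bipartite, becomes a loop). A \emph{partial retract} $\widehat{G}$ of a graph $G$ is a graph obtained from $G$ by applying restricted bicontractions repeatedly until none is applicable. Theorem. Let $G$ be a graph that is not isomorphic to the $4$-cycle $C_4$. Then $G$ has a partial retract, and for every partial retract $\widehat{G}$ of $G$ (whatever the sequence of restricted bicontractions),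 $G\in\mathcal{H}_0$ if and only if $\widehat{G}\in\mathcal{H}_2$. -/

import Mathlib

namespace Graph

section

variable {α β α' β' : Type*}

/-- The degree of a vertex: the number of incident links plus twice the number of loops. -/
noncomputable def degree (G : Graph α β) (x : α) : ℕ :=
  {e | G.IsNonloopAt e x}.ncard + 2 * {e | G.IsLoopAt e x}.ncard

/-- Any two vertices are joined by a walk, and there is at least one vertex. -/
def IsConnected (G : Graph α β) : Prop :=
  V(G).Nonempty ∧ ∀ x ∈ V(G), ∀ y ∈ V(G), Relation.ReflTransGen G.Adj x y

/-- `G` is bipartite: for some set `A`, each edge has one end in `A` and one end outside `A`. -/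
def IsBipartite (G : Graph α β) : Prop :=
  ∃ A : Set α, ∀ e x y, G.IsLink e x y → (x ∈ A ↔ y ∉ A)

/-- A set of links such that each vertex is incident with exactly one of them. -/
structure IsPerfectMatching (G : Graph α β) (M : Set β) : Prop where
  subset : M ⊆ E(G)
  not_isLoopAt : ∀ e ∈ M, ∀ x, ¬ G.IsLoopAt e x
  existsUnique : ∀ x ∈ V(G), ∃! e, e ∈ M ∧ G.Inc e x

/-- A connected graph of order at least four, each edge of which is in some perfect matching. -/
structure IsMatchingCovered (G : Graph α β) : Prop where
  connected : G.IsConnected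
  four_le : 4 ≤ V(G).ncard
  exists_perfectMatching : ∀ e ∈ E(G), ∃ M, G.IsPerfectMatching M ∧ e ∈ M

/-- A bipartite matching covered graph such that deleting any edge leaves a graph that is not
matching covered. -/
structure IsMinimalBipartiteMatchingCovered (G : Graph α β) : Prop where
  bipartite : G.IsBipartite
  matchingCovered : G.IsMatchingCovered
  minimal : ∀ e ∈ E(G), ¬ (G.deleteEdges {e}).IsMatchingCovered

/-- The set of vertices of degree two. -/
def twoVertices (G : Graph α β) : Set α := {x ∈ V(G) | G.degree x = 2}

/-- The set of edges both of whose ends have degree two. -/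
def twoEdges (G : Graph α β) : Set β := {e ∈ E(G) | ∀ x, G.Inc e x → G.degree x = 2}

/-- The class `H₀`: minimal bipartite matching covered graphs with `|E₂| = m - n + 2`. -/
def IsTwoEdgeExtremal (G : Graph α β) : Prop :=
  G.IsMinimalBipartiteMatchingCovered ∧
    (G.twoEdges.ncard : ℤ) = (E(G).ncard : ℤ) - (V(G).ncard : ℤ) + 2

/-- The class `H₂`: minimal bipartite matching covered graphs with `|V₂| = 2 (m - n + 2)`. -/
def IsTwoVertexExtremal (G : Graph α β) : Prop :=
  G.IsMinimalBipartiteMatchingCovered ∧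
    (G.twoVertices.ncard : ℤ) = 2 * ((E(G).ncard : ℤ) - (V(G).ncard : ℤ) + 2)

open Classical in
/-- Delete the edges `e₁` and `e₂` and identify the vertices `v₁` and `v₂` with `v`. When `e₁` joins
`v` to `v₁` and `e₂` joins `v` to `v₂`, this is the contraction of `e₁` and `e₂`. All other edges
are kept: parallel edges may arise, and an edge joining `v₁` to `v₂` becomes a loop. -/
noncomputable def contractPair (G : Graph α β) (v v₁ v₂ : α) (e₁ e₂ : β) : Graph α β :=
  (G.deleteEdges {e₁, e₂}).map fun x => if x = v₁ ∨ x = v₂ then v else x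

/-- `G'` is obtained from `G` by the restricted bicontraction of some vertex `v`: the vertex `v` has
degree two and two distinct neighbours, each of degree at least three, and `G'` is obtained by
contracting the two edges at `v`. -/
def RestrictedBicontraction (G G' : Graph α β) : Prop :=
  ∃ v v₁ v₂ e₁ e₂, G.IsLink e₁ v v₁ ∧ G.IsLink e₂ v v₂ ∧ v₁ ≠ v₂ ∧ G.degree v = 2 ∧
    3 ≤ G.degree v₁ ∧ 3 ≤ G.degree v₂ ∧ G' = G.contractPair v v₁ v₂ e₁ e₂

/-- `H` is a partial retract of `G`: it arises from `G` by finitely many (possibly zero) restricted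
bicontractions, and no restricted bicontraction can be applied to `H`. -/
def IsPartialRetract (G H : Graph α β) : Prop :=
  Relation.ReflTransGen RestrictedBicontraction G H ∧ ∀ H', ¬ RestrictedBicontraction H H'

/-- Isomorphism of multigraphs. -/
def IsIsomorphic (G : Graph α β) (H : Graph α' β') : Prop :=
  ∃ (φ : V(G) ≃ V(H)) (ψ : E(G) ≃ E(H)), ∀ (e : E(G)) (x y : V(G)),
    G.IsLink e x y ↔ H.IsLink (ψ e) (φ x) (φ y)

/-- The cycle of length four. -/
def cycleFour : Graph (Fin 4) (Sym2 (Fin 4)) := ofSimpleGraph (SimpleGraph.cycleGraph 4)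

end

end Graph

/-! The quantity m - n + 2 is unchanged by a restricted bicontraction, which removes two vertices
and two edges. Such a contraction also preserves minimality in both directions, and it neither
creates nor destroys an edge with both ends of degree 2, since the merged vertex has degree at least
4. Hence membership in H₀ passes along every sequence of contractions, and it remains to compare the
two extremality conditions on a graph with no restricted bicontraction.

There, every vertex of degree 2 has a neighbour of degree 2, so double counting incidences gives
|V₂| ≤ 2|E₂|. The general bound |V₂| ≥ 2(m - n + 2) for minimal graphs then turns |E₂| = m - n + 2
into |V₂| = 2(m - n + 2). Conversely, suppose |V₂| is extremal and some vertex of degree 2 has both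
neighbours of degree 2. Bicontracting it leaves a minimal graph with the same m - n and two fewer
vertices of degree 2, against the bound. So each vertex of degree 2 lies on exactly one edge of E₂,
and |V₂| = 2|E₂|. This needs n ≥ 6. A minimal graph with n = 4 is C₄, and C₄ is never the result of
a restricted bicontraction, because the merged vertex has too large a degree.

The bound (`card_pairs_add_two_le`, applied to each colour class) is the deep part. A balanced
bipartite graph is matching covered exactly when every nonempty proper set Z of left vertices
encloses fewer than |Z| right vertices. In a minimal graph, each edge then has a tight set, a
barrier, that forbids its deletion. Barriers show that the edges at left vertices of degree at least
3, together with those at one further left vertex, form a forest (`not_isDense`). Counting the edges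
of this forest gives the bound. -/

namespace Graph

/-! ### Dense sets of pairs -/

section StrictHall

open Finset Classical

variable {A B : Type*}

/-- A nonempty set of pairs with at least as many pairs as elements that occur in them. -/
def IsDense (D : Finset (A × B)) : Prop :=
  D.Nonempty ∧ (D.image Prod.fst).card + (D.image Prod.snd).card ≤ D.card

/-- If a pair were alone in its row or column, erasing it would lose one pair and at least one
element, so the rest would still be dense. Thus a minimal dense set, like a cycle, has all degrees
at least 2. -/
theorem IsDense.exists_pair {D : Finset (A × B)} (hD : IsDense D)
    (hmin : ∀ D' ⊆ D, IsDense D' → D' = D) {p : A × B} (hp : p ∈ D) :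
    (∃ q ∈ D, q ≠ p ∧ q.1 = p.1) ∧ ∃ q ∈ D, q ≠ p ∧ q.2 = p.2 := by
  by_contra hcon
  have hlt : ((D.erase p).image Prod.fst).card + ((D.erase p).image Prod.snd).card + 1 ≤
      (D.image Prod.fst).card + (D.image Prod.snd).card := by
    have m1 : (D.erase p).image Prod.fst ⊆ D.image Prod.fst := image_subset_image (erase_subset _ _)
    have m2 : (D.erase p).image Prod.snd ⊆ D.image Prod.snd := image_subset_image (erase_subset _ _)
    rw [not_and_or] at hcon
    rcases hcon with h | h
    · have : (D.erase p).image Prod.fst ⊂ D.image Prod.fst := by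
        refine (ssubset_iff_of_subset m1).2 ⟨p.1, mem_image_of_mem _ hp, fun hx => h ?_⟩
        obtain ⟨q, hq, hqe⟩ := mem_image.1 hx
        exact ⟨q, mem_of_mem_erase hq, ne_of_mem_erase hq, hqe⟩
      have := card_lt_card this
      have := card_le_card m2
      omega
    · have : (D.erase p).image Prod.snd ⊂ D.image Prod.snd := by
        refine (ssubset_iff_of_subset m2).2 ⟨p.2, mem_image_of_mem _ hp, fun hx => h ?_⟩
        obtain ⟨q, hq, hqe⟩ := mem_image.1 hx
        exact ⟨q, mem_of_mem_erase hq, ne_of_mem_erase hq, hqe⟩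
      have := card_lt_card this
      have := card_le_card m1
      omega
  have hc := card_erase_add_one hp
  have hd := hD.2
  have hdense : IsDense (D.erase p) := by
    refine ⟨?_, by omega⟩
    rw [← card_pos]
    have h1 : 0 < (D.image Prod.fst).card := card_pos.2 ⟨_, mem_image_of_mem _ hp⟩
    have h2 : 0 < (D.image Prod.snd).card := card_pos.2 ⟨_, mem_image_of_mem _ hp⟩
    omega
  have := hmin _ (erase_subset _ _) hdense
  have hp' : p ∈ D.erase p := by rwa [this]
  exact notMem_erase p D hp'

theorem two_mul_card_image_le {ι κ : Type*} {D : Finset ι} {f : ι → κ} {T : Finset κ}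
    (hT : T ⊆ D.image f) (h : ∀ p ∈ D, f p ∈ T → ∃ q ∈ D, q ≠ p ∧ f q = f p) :
    2 * T.card ≤ (D.filter fun p => f p ∈ T).card := by
  rw [card_eq_sum_card_fiberwise (s := D.filter fun p => f p ∈ T) (t := T) (f := f)
    (fun p hp => (mem_filter.1 hp).2), mul_comm, ← smul_eq_mul]
  apply card_nsmul_le_sum
  intro k hk
  obtain ⟨p, hp, rfl⟩ := mem_image.1 (hT hk)
  obtain ⟨q, hq, hqp, hqe⟩ := h p hp hk
  have : ({q, p} : Finset ι) ⊆ (D.filter fun p => f p ∈ T).filter fun x => f x = f p := by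
    intro x hx
    rw [mem_insert, mem_singleton] at hx
    rcases hx with rfl | rfl
    · simp [hq, hqe, hk]
    · simp [hp, hk]
  simpa [card_pair hqp] using card_le_card this

/-! ### The strict Hall condition, barriers and the forest theorem -/

variable [Fintype A] [Fintype B] {R : A → B → Prop}

/-- The elements of `B` all of whose neighbours lie in `Z`. -/
noncomputable def enclosed (R : A → B → Prop) (Z : Finset A) : Finset B :=
  univ.filter fun b => ∀ a, R a b → a ∈ Z

theorem mem_enclosed {Z : Finset A} {b : B} : b ∈ enclosed R Z ↔ ∀ a, R a b → a ∈ Z := by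
  simp [enclosed]

/-- Every nonempty proper subset `Z` of `A` encloses fewer than `|Z|` elements of `B`. -/
def StrictHall (R : A → B → Prop) : Prop :=
  ∀ Z : Finset A, Z.Nonempty → Z ≠ univ → (enclosed R Z).card < Z.card

/-- A tight set witnessing that the pair `(a, b)` cannot be removed from `R`
without violating `StrictHall`. -/
structure IsBarrier (R : A → B → Prop) (a : A) (b : B) (Z : Finset A) : Prop where
  notMem : a ∉ Z
  mem : ∀ a', R a' b → a' ≠ a → a' ∈ Z
  nonempty : Z.Nonempty
  tight : (enclosed R Z).card + 1 = Z.card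

theorem enclosed_mono {Z W : Finset A} (h : Z ⊆ W) : enclosed R Z ⊆ enclosed R W :=
  fun _ hb => mem_enclosed.2 fun a ha => h (mem_enclosed.1 hb a ha)

theorem enclosed_inter (Z W : Finset A) : enclosed R (Z ∩ W) = enclosed R Z ∩ enclosed R W := by
  ext b
  simp only [mem_enclosed, mem_inter]
  exact ⟨fun h => ⟨fun a ha => (h a ha).1, fun a ha => (h a ha).2⟩,
    fun h a ha => ⟨h.1 a ha, h.2 a ha⟩⟩

/-- Uncrossing: `Z ∩ W` encloses at most |Z ∩ W| - 1 elements, so the union of the two enclosed sets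
already has at least |Z ∪ W| - 1, the most that `Z ∪ W` may enclose. -/
theorem StrictHall.enclosed_union (hR : StrictHall R) {Z W : Finset A}
    (hZ : (enclosed R Z).card + 1 = Z.card) (hW : (enclosed R W).card + 1 = W.card)
    (hI : (Z ∩ W).Nonempty) (hU : Z ∪ W ≠ univ) :
    enclosed R (Z ∪ W) = enclosed R Z ∪ enclosed R W := by
  symm
  apply eq_of_subset_of_card_le
    (union_subset (enclosed_mono subset_union_left) (enclosed_mono subset_union_right))
  have h1 := hR (Z ∩ W) hI (fun h => hU (by
    rw [eq_univ_iff_forall] at h ⊢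
    exact fun a => mem_union_left _ (mem_inter.1 (h a)).1))
  have h2 := hR (Z ∪ W) (hI.mono (inter_subset_left.trans subset_union_left)) hU
  rw [enclosed_inter] at h1
  have h3 := card_union_add_card_inter Z W
  have h4 := card_union_add_card_inter (enclosed R Z) (enclosed R W)
  omega

theorem IsBarrier.notMem_enclosed {a : A} {b : B} {Z : Finset A} (h : IsBarrier R a b Z)
    (hab : R a b) : b ∉ enclosed R Z :=
  fun hb => h.notMem (mem_enclosed.1 hb a hab)

/-- All left elements but `a` enclose at most |A| - 2 of the |A| right elements; the others are
neighbours of `a`. -/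
theorem StrictHall.two_le_card_left (hR : StrictHall R) (hAB : Fintype.card A = Fintype.card B)
    (hA : 2 ≤ Fintype.card A) (a : A) : 2 ≤ (univ.filter (R a)).card := by
  have h1 := hR (univ.erase a) (by rw [← card_pos, card_erase_of_mem (mem_univ a), card_univ]; omega)
    (fun h => notMem_erase a univ (h.symm ▸ mem_univ a))
  have h2 : (univ : Finset B) ⊆ enclosed R (univ.erase a) ∪ univ.filter (R a) := by
    intro b _
    by_cases hb : R a b
    · simp [hb]
    · simp only [mem_union, mem_enclosed, mem_erase, mem_univ, and_true]
      exact Or.inl fun a' ha' h => hb (h ▸ ha')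
  have h3 := (card_le_card h2).trans (card_union_le _ _)
  rw [card_erase_of_mem (mem_univ a)] at h1
  simp only [card_univ] at h1 h3
  omega

theorem StrictHall.exists_ne (hR : StrictHall R) (hA : 2 ≤ Fintype.card A) (a : A) (b : B) :
    ∃ a', a' ≠ a ∧ R a' b := by
  by_contra! h
  have h1 := hR {a} ⟨a, mem_singleton_self a⟩ (fun h => by
    have := congrArg card h
    rw [card_singleton, card_univ] at this
    omega)
  rw [card_singleton, Nat.lt_one_iff, card_eq_zero] at h1
  have : b ∈ enclosed R {a} := mem_enclosed.2 fun a' ha' => by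
    rw [mem_singleton]
    by_contra hne
    exact h a' hne ha'
  simp [h1] at this

/-- If the barriers met, their union would be tight, and adding `a` would enclose both `b` and `b'`,
which is too many unless nothing is left outside. In that case the union encloses all but two right
elements, which is impossible when `a` has three neighbours. -/
theorem IsBarrier.disjoint (hR : StrictHall R) (hAB : Fintype.card A = Fintype.card B)
    {a : A} {b b' : B} {Z Z' : Finset A} (hab : R a b) (hab' : R a b') (hne : b ≠ b')
    (hdeg : 3 ≤ (univ.filter (R a)).card)
    (h : IsBarrier R a b Z) (h' : IsBarrier R a b' Z') : Disjoint Z Z' := by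
  by_contra hdis
  rw [not_disjoint_iff_nonempty_inter] at hdis
  have hau : a ∉ Z ∪ Z' := by simp [h.notMem, h'.notMem]
  have hU : Z ∪ Z' ≠ univ := fun hu => hau (hu ▸ mem_univ a)
  have hun := hR.enclosed_union h.tight h'.tight hdis hU
  have hbu : b ∉ enclosed R (Z ∪ Z') := fun hb => hau (mem_enclosed.1 hb a hab)
  have hbu' : b' ∉ enclosed R (Z ∪ Z') := fun hb => hau (mem_enclosed.1 hb a hab')
  have h1 := hR (Z ∩ Z') hdis (fun hi => by
    rw [eq_univ_iff_forall] at hi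
    exact h.notMem (mem_inter.1 (hi a)).1)
  rw [enclosed_inter] at h1
  have h3 := card_union_add_card_inter Z Z'
  have h4 := card_union_add_card_inter (enclosed R Z) (enclosed R Z')
  rw [← hun] at h4
  have ht := h.tight
  have ht' := h'.tight
  set W := insert a (Z ∪ Z') with hW
  have hWc : W.card = (Z ∪ Z').card + 1 := card_insert_of_notMem hau
  have hsub : insert b (insert b' (enclosed R (Z ∪ Z'))) ⊆ enclosed R W := by
    intro x hx
    rw [mem_enclosed]
    intro a' ha'
    rw [hW, mem_insert, mem_union]
    by_cases haa : a' = a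
    · exact Or.inl haa
    · right
      rw [mem_insert, mem_insert] at hx
      rcases hx with rfl | rfl | hx
      · exact Or.inl (h.mem a' ha' haa)
      · exact Or.inr (h'.mem a' ha' haa)
      · exact mem_union.1 (mem_enclosed.1 hx a' ha')
  have hc := card_le_card hsub
  rw [card_insert_of_notMem (by simp [hne, hbu]), card_insert_of_notMem hbu'] at hc
  have hWu : W = univ := by
    by_contra hWu
    have := hR W ⟨a, mem_insert_self _ _⟩ hWu
    omega
  have hcov : enclosed R (Z ∪ Z') ⊆ univ \ univ.filter (R a) := by
    intro x hx
    simp only [mem_sdiff, mem_univ, mem_filter, true_and]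
    exact fun hax => hau (mem_enclosed.1 hx a hax)
  have h5 := card_le_card hcov
  have h6 := card_sdiff_add_card_eq_card (subset_univ (univ.filter (R a)))
  rw [hWu, card_univ] at hWc
  rw [card_univ] at h6
  omega

theorem exists_maximal_isBarrier {a : A} {b : B} (h : ∃ Z, IsBarrier R a b Z) :
    ∃ Z, IsBarrier R a b Z ∧ ∀ Z', IsBarrier R a b Z' → Z ⊆ Z' → Z' ⊆ Z := by
  obtain ⟨Z, hZ⟩ := (Set.toFinite {Z | IsBarrier R a b Z}).exists_maximal h
  exact ⟨Z, hZ.1, fun Z' h1 h2 => hZ.2 h1 h2⟩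

/-- The barrier of one pair either covers the complement of a maximal barrier of another pair
or does not leave it. -/
theorem IsBarrier.mem_enclosed_of_union_ne_univ (hR : StrictHall R)
    (hA : 2 ≤ Fintype.card A) {r a : A} {b₀ b : B} {Z₀ Z : Finset A} (hrb : R r b₀) (hab : R a b)
    (h₀ : IsBarrier R r b₀ Z₀) (hmax : ∀ Z', IsBarrier R r b₀ Z' → Z₀ ⊆ Z' → Z' ⊆ Z₀)
    (h : IsBarrier R a b Z) (ha : a ∈ Z₀) (hb : b ≠ b₀) (hU : Z₀ ∪ Z ≠ univ) :
    b ∈ enclosed R Z₀ := by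
  have hbU : b ∈ enclosed R (Z₀ ∪ Z) := mem_enclosed.2 fun a' ha' => by
    by_cases haa : a' = a
    · exact mem_union_left _ (haa ▸ ha)
    · exact mem_union_right _ (h.mem a' ha' haa)
  by_cases hI : (Z₀ ∩ Z).Nonempty
  · rw [hR.enclosed_union h₀.tight h.tight hI hU] at hbU
    exact (mem_union.1 hbU).resolve_right (h.notMem_enclosed hab)
  by_contra hbn
  have hdis : Disjoint Z₀ Z := by rwa [← not_disjoint_iff_nonempty_inter, not_not] at hI
  have hZc : (Z₀ ∪ Z).card = Z₀.card + Z.card := card_union_of_disjoint hdis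
  have hYdis : Disjoint (enclosed R Z₀) (enclosed R Z) := by
    rw [disjoint_left]
    intro x hx hx'
    obtain ⟨a', -, ha'⟩ := hR.exists_ne hA a x
    exact disjoint_left.1 hdis (mem_enclosed.1 hx a' ha') (mem_enclosed.1 hx' a' ha')
  have hYc := card_union_of_disjoint hYdis
  have hbn' : b ∉ enclosed R Z₀ ∪ enclosed R Z := by
    rw [mem_union]
    exact fun hx => hx.elim hbn (h.notMem_enclosed hab)
  have hYU : enclosed R Z₀ ∪ enclosed R Z ⊆ enclosed R (Z₀ ∪ Z) :=
    union_subset (enclosed_mono subset_union_left) (enclosed_mono subset_union_right)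
  have hlt := hR _ (h₀.nonempty.mono subset_union_left) hU
  have ht₀ := h₀.tight
  have ht := h.tight
  have hsub1 : insert b (enclosed R Z₀ ∪ enclosed R Z) ⊆ enclosed R (Z₀ ∪ Z) :=
    insert_subset hbU hYU
  have hc1 := card_le_card hsub1
  rw [card_insert_of_notMem hbn'] at hc1
  -- If `r ∈ Z`, then `b₀` is enclosed as well and no deficiency remains; otherwise `Z₀ ∪ Z` is a
  -- larger barrier of `(r, b₀)`, against maximality.
  by_cases hr : r ∈ Z
  · have hb₀U : b₀ ∈ enclosed R (Z₀ ∪ Z) := mem_enclosed.2 fun a' ha' => by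
      by_cases haa : a' = r
      · exact mem_union_right _ (haa ▸ hr)
      · exact mem_union_left _ (h₀.mem a' ha' haa)
    have hb₀n : b₀ ∉ insert b (enclosed R Z₀ ∪ enclosed R Z) := by
      rw [mem_insert, mem_union]
      rintro (hx | hx | hx)
      · exact hb hx.symm
      · exact h₀.notMem_enclosed hrb hx
      · obtain ⟨a', hne, ha'⟩ := hR.exists_ne hA r b₀
        exact disjoint_left.1 hdis (h₀.mem a' ha' hne) (mem_enclosed.1 hx a' ha')
    have hc2 := card_le_card (insert_subset hb₀U hsub1)
    rw [card_insert_of_notMem hb₀n, card_insert_of_notMem hbn'] at hc2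
    omega
  · have hbar : IsBarrier R r b₀ (Z₀ ∪ Z) :=
      ⟨by simp [h₀.notMem, hr], fun a' h1 h2 => mem_union_left _ (h₀.mem a' h1 h2),
        h₀.nonempty.mono subset_union_left, by omega⟩
    obtain ⟨z, hz⟩ := h.nonempty
    exact disjoint_left.1 hdis (hmax _ hbar subset_union_left (mem_union_right _ hz)) hz

/-- Pairs whose left elements, with one exception, have at least three neighbours
form a forest. -/
theorem StrictHall.not_isDense (hR : StrictHall R) (hAB : Fintype.card A = Fintype.card B)
    (hA : 2 ≤ Fintype.card A) (hmin : ∀ a b, R a b → ∃ Z, IsBarrier R a b Z) (c : A)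
    {D₀ : Finset (A × B)}
    (hD₀ : ∀ p ∈ D₀, R p.1 p.2 ∧ (p.1 ≠ c → 3 ≤ (univ.filter (R p.1)).card)) :
    ¬ IsDense D₀ := by
  intro hdense
  obtain ⟨D, hDD₀, hDmin⟩ := exists_minimal_le_of_wellFoundedLT IsDense D₀ hdense
  have hD : IsDense D := hDmin.1
  have hDm : ∀ D' ⊆ D, IsDense D' → D' = D := fun D' h1 h2 => subset_antisymm h1 (hDmin.2 h2 h1)
  have hDR : ∀ p ∈ D, R p.1 p.2 := fun p hp => (hD₀ p (hDD₀ hp)).1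
  have hD3 : ∀ p ∈ D, p.1 ≠ c → 3 ≤ (univ.filter (R p.1)).card :=
    fun p hp => (hD₀ p (hDD₀ hp)).2
  have hex : ∀ p : A × B, ∃ Z, R p.1 p.2 → IsBarrier R p.1 p.2 Z ∧
      ∀ Z', IsBarrier R p.1 p.2 Z' → Z ⊆ Z' → Z' ⊆ Z := by
    intro p
    by_cases hp : R p.1 p.2
    · obtain ⟨Z, hZ⟩ := exists_maximal_isBarrier (hmin _ _ hp)
      exact ⟨Z, fun _ => hZ⟩
    · exact ⟨∅, fun h => absurd h hp⟩
  choose Z hZ using hex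
  have hdis : ∀ p ∈ D, ∀ q ∈ D, p ≠ q → p.1 = q.1 → p.1 ≠ c → Disjoint (Z p) (Z q) := by
    intro p hp q hq hpq h1 hc
    refine IsBarrier.disjoint hR hAB (hDR p hp) (h1 ▸ hDR q hq)
      (fun h2 => hpq (Prod.ext h1 h2)) (hD3 p hp hc) (hZ p (hDR p hp)).1 ?_
    rw [h1]
    exact (hZ q (hDR q hq)).1
  -- Two pairs of `D` at a left element other than `c` have disjoint barriers, so one of these
  -- avoids `c`.
  have hstart : (D.filter fun p => p.1 ≠ c ∧ c ∉ Z p).Nonempty := by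
    obtain ⟨p, hp⟩ := hD.1
    obtain ⟨p', hp', hpc⟩ : ∃ p' ∈ D, p'.1 ≠ c := by
      by_cases hpc : p.1 = c
      · obtain ⟨q, hq, hqp, hq2⟩ := (hD.exists_pair hDm hp).2
        exact ⟨q, hq, fun hqc => hqp (Prod.ext (hqc.trans hpc.symm) hq2)⟩
      · exact ⟨p, hp, hpc⟩
    obtain ⟨q, hq, hqp, hq1⟩ := (hD.exists_pair hDm hp').1
    by_cases hc : c ∈ Z p'
    · exact ⟨q, mem_filter.2 ⟨hq, hq1 ▸ hpc,
        disjoint_left.1 (hdis p' hp' q hq hqp.symm hq1.symm hpc) hc⟩⟩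
    · exact ⟨p', mem_filter.2 ⟨hp', hpc, hc⟩⟩
  obtain ⟨p₀, hp₀, hp₀min⟩ := exists_min_image _ (fun p => (Z p).card) hstart
  obtain ⟨hp₀D, hp₀c, hcZ⟩ := mem_filter.1 hp₀
  obtain ⟨hbar, hbmax⟩ := hZ p₀ (hDR p₀ hp₀D)
  -- A pair leaving `Z p₀` would have a barrier covering the complement of `Z p₀`. A second pair of
  -- `D` at the same left element would then have its barrier properly inside `Z p₀`, against the
  -- choice of `p₀`.
  have hclosed : ∀ p ∈ D, p.1 ∈ Z p₀ → p.2 ≠ p₀.2 → p.2 ∈ enclosed R (Z p₀) := by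
    intro p hp hpZ hne
    refine IsBarrier.mem_enclosed_of_union_ne_univ hR hA (hDR p₀ hp₀D) (hDR p hp) hbar hbmax
      (hZ p (hDR p hp)).1 hpZ hne fun hU => ?_
    have hpc : p.1 ≠ c := fun h => hcZ (h ▸ hpZ)
    obtain ⟨q, hq, hqp, hq1⟩ := (hD.exists_pair hDm hp).1
    have hqd := hdis p hp q hq hqp.symm hq1.symm hpc
    have hsub : Z q ⊆ Z p₀ := by
      intro x hx
      exact (mem_union.1 (hU ▸ mem_univ x)).resolve_right (disjoint_right.1 hqd hx)
    have hqc : c ∉ Z q := fun h => hcZ (hsub h)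
    have hss : Z q ⊂ Z p₀ := (ssubset_iff_of_subset hsub).2
      ⟨p.1, hpZ, hq1 ▸ (hZ q (hDR q hq)).1.notMem⟩
    have := hp₀min q (mem_filter.2 ⟨hq, hq1 ▸ hpc, hqc⟩)
    exact absurd (card_lt_card hss) (not_lt.2 this)
  -- These pairs form a smaller dense set: all degrees in it are at least 2, except possibly that of
  -- `p₀.2`, which is at least 1. So twice the number of elements is at most 2|D'| + 1, and parity
  -- removes the excess.
  set D' := D.filter fun p => p.1 ∈ Z p₀ with hD'
  have hne : D'.Nonempty := by
    obtain ⟨q, hq, hqp, hq2⟩ := (hD.exists_pair hDm hp₀D).2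
    exact ⟨q, mem_filter.2 ⟨hq, hbar.mem q.1 (hq2 ▸ hDR q hq) fun h => hqp (Prod.ext h hq2)⟩⟩
  have hc1 : 2 * (D'.image Prod.fst).card ≤ D'.card := by
    refine (two_mul_card_image_le subset_rfl fun p hp _ => ?_).trans (card_filter_le _ _)
    obtain ⟨hpD, hpZ⟩ := mem_filter.1 hp
    obtain ⟨q, hq, hqp, hq1⟩ := (hD.exists_pair hDm hpD).1
    exact ⟨q, mem_filter.2 ⟨hq, hq1 ▸ hpZ⟩, hqp, hq1⟩
  have hb₀ : p₀.2 ∈ D'.image Prod.snd := by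
    obtain ⟨q, hq, hqp, hq2⟩ := (hD.exists_pair hDm hp₀D).2
    exact mem_image.2 ⟨q, mem_filter.2
      ⟨hq, hbar.mem q.1 (hq2 ▸ hDR q hq) fun h => hqp (Prod.ext h hq2)⟩, hq2⟩
  have hc2 : 2 * ((D'.image Prod.snd).erase p₀.2).card ≤
      (D'.filter fun p => p.2 ∈ (D'.image Prod.snd).erase p₀.2).card := by
    refine two_mul_card_image_le (erase_subset _ _) fun p hp hpe => ?_
    obtain ⟨hpD, hpZ⟩ := mem_filter.1 hp
    obtain ⟨q, hq, hqp, hq2⟩ := (hD.exists_pair hDm hpD).2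
    have hpY := hclosed p hpD hpZ (ne_of_mem_erase hpe)
    exact ⟨q, mem_filter.2 ⟨hq, mem_enclosed.1 hpY q.1 (hq2 ▸ hDR q hq)⟩, hqp, hq2⟩
  have hc3 : (D'.filter fun p => p.2 ∈ (D'.image Prod.snd).erase p₀.2).card < D'.card := by
    obtain ⟨q, hq, hq2⟩ := mem_image.1 hb₀
    exact card_lt_card ((ssubset_iff_of_subset (filter_subset _ _)).2 ⟨q, hq, by simp [hq2]⟩)
  have hc4 := card_erase_add_one hb₀
  have heq := hDm D' (filter_subset _ _) ⟨hne, by omega⟩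
  have : p₀ ∈ D' := heq ▸ hp₀D
  exact hbar.notMem (mem_filter.1 this).2

/-- A forest has fewer edges than vertices. The forest here consists of the pairs at left elements
of degree at least 3 and at one exceptional `c`; taking `c` of degree 2 is what yields the summand 2
instead of 1. -/
theorem StrictHall.card_pairs_add_two_le (hR : StrictHall R)
    (hAB : Fintype.card A = Fintype.card B) (hA : 2 ≤ Fintype.card A)
    (hmin : ∀ a b, R a b → ∃ Z, IsBarrier R a b Z) :
    (∑ a, (univ.filter (R a)).card) + 2 ≤
      2 * Fintype.card A + (univ.filter fun a => (univ.filter (R a)).card = 2).card := by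
  have hdeg := hR.two_le_card_left hAB hA
  have key : ∀ c : A, ∑ a ∈ insert c (univ.filter fun a => ¬ (univ.filter (R a)).card = 2),
      (univ.filter (R a)).card <
      (insert c (univ.filter fun a => ¬ (univ.filter (R a)).card = 2)).card + Fintype.card A := by
    intro c
    set S := insert c (univ.filter fun a => ¬ (univ.filter (R a)).card = 2) with hS
    by_contra! hle
    set D : Finset (A × B) := univ.filter fun p => p.1 ∈ S ∧ R p.1 p.2 with hD
    have hDc : D.card = ∑ a ∈ S, (univ.filter (R a)).card := by
      rw [card_eq_sum_card_fiberwise (s := D) (t := S) (f := Prod.fst)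
        (fun p hp => (mem_filter.1 hp).2.1)]
      refine sum_congr rfl fun a ha => ?_
      refine card_bij' (fun p _ => p.2) (fun b _ => (a, b)) ?_ ?_ ?_ ?_
      · rintro ⟨a', b⟩ h
        simp only [hD, mem_filter, mem_univ, true_and] at h ⊢
        obtain ⟨⟨-, h⟩, rfl⟩ := h
        exact h
      · intro b h
        simp only [hD, mem_filter, mem_univ, true_and] at h ⊢
        exact ⟨⟨ha, h⟩, trivial⟩
      · rintro ⟨a', b⟩ h
        simp only [mem_filter] at h
        rw [← h.2]
      · intro b h
        rfl
    refine hR.not_isDense hAB hA hmin c (D₀ := D) ?_ ⟨?_, ?_⟩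
    · intro p hp
      obtain ⟨-, hpS, hpR⟩ := mem_filter.1 hp
      refine ⟨hpR, fun hne => ?_⟩
      have h1 := (mem_filter.1 ((mem_insert.1 hpS).resolve_left hne)).2
      have h2 := hdeg p.1
      omega
    · rw [← card_pos]
      omega
    · have h1 : (D.image Prod.fst).card ≤ S.card := card_le_card fun a ha => by
        obtain ⟨p, hp, rfl⟩ := mem_image.1 ha
        exact (mem_filter.1 hp).2.1
      have h2 : (D.image Prod.snd).card ≤ Fintype.card B := card_le_univ _
      omega
  have hsplit := sum_filter_add_sum_filter_not univ (fun a => (univ.filter (R a)).card = 2)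
    fun a => (univ.filter (R a)).card
  have hcsplit := card_filter_add_card_filter_not (s := (univ : Finset A))
    (fun a => (univ.filter (R a)).card = 2)
  have hsum2 : ∑ a ∈ univ.filter (fun a => (univ.filter (R a)).card = 2),
      (univ.filter (R a)).card = (univ.filter fun a => (univ.filter (R a)).card = 2).card * 2 :=
    sum_const_nat fun a ha => (mem_filter.1 ha).2
  rw [card_univ] at hcsplit
  rcases (univ.filter fun a => (univ.filter (R a)).card = 2).eq_empty_or_nonempty with h0 | ⟨c, hc⟩
  -- With all degrees at least 3 the whole relation would be a forest, yet it has at least 3|A|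
  -- pairs on 2|A| elements.
  · obtain ⟨c⟩ : Nonempty A := Fintype.card_pos_iff.1 (by omega)
    have hcm : c ∈ univ.filter fun a => ¬ (univ.filter (R a)).card = 2 := by
      rw [mem_filter]
      refine ⟨mem_univ _, fun h => ?_⟩
      have : c ∈ univ.filter fun a => (univ.filter (R a)).card = 2 := mem_filter.2 ⟨mem_univ _, h⟩
      simp [h0] at this
    have hk := key c
    rw [insert_eq_of_mem hcm] at hk
    have h3 : (univ.filter fun a => ¬ (univ.filter (R a)).card = 2).card * 3 ≤
        ∑ a ∈ univ.filter (fun a => ¬ (univ.filter (R a)).card = 2), (univ.filter (R a)).card := by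
      rw [← smul_eq_mul]
      refine card_nsmul_le_sum _ _ _ fun a ha => ?_
      have h1 := (mem_filter.1 ha).2
      have h2 := hdeg a
      omega
    have := card_eq_zero.2 h0
    omega
  · have hcd := (mem_filter.1 hc).2
    have hcm : c ∉ univ.filter fun a => ¬ (univ.filter (R a)).card = 2 := fun h =>
      (mem_filter.1 h).2 hcd
    have hk := key c
    rw [sum_insert hcm, card_insert_of_notMem hcm, hcd] at hk
    omega

end StrictHall

end Graph

/-! ### Matchings from the strict Hall condition -/

namespace Graph

section StrictHall

open Finset Classical

variable {A B : Type*} [Fintype A] [Fintype B] {R : A → B → Prop}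

/-- A form of Hall's theorem: each pair extends to a bijection along `R`. -/
theorem StrictHall.exists_equiv (hR : StrictHall R) (hAB : Fintype.card A = Fintype.card B)
    (hA : 2 ≤ Fintype.card A) {a₀ : A} {b₀ : B} (h₀ : R a₀ b₀) :
    ∃ f : A ≃ B, f a₀ = b₀ ∧ ∀ a, R a (f a) := by
  -- The candidate lists reserve `a₀` for `b₀`; the strict inequality in the Hall condition pays for
  -- removing `a₀` from the other lists.
  let t : B → Finset A := fun b =>
    if b = b₀ then {a₀} else (univ.filter fun a => R a b).erase a₀
  have hall : ∀ s : Finset B, s.card ≤ (s.biUnion t).card := by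
    intro s
    set T := s.erase b₀ with hT
    set W := T.biUnion fun b => univ.filter fun a => R a b with hW
    have hTW : T ⊆ enclosed R W := fun b hb => mem_enclosed.2 fun a ha =>
      mem_biUnion.2 ⟨b, hb, by simpa using ha⟩
    have hTle : T.card ≤ (W.erase a₀).card := by
      rcases T.eq_empty_or_nonempty with h0 | ⟨b, hb⟩
      · simp [h0]
      by_cases hWu : W = univ
      · rw [hWu, card_erase_of_mem (mem_univ _), card_univ]
        have : T.card < Fintype.card B := by
          rw [← card_univ]
          exact card_lt_card ((ssubset_iff_of_subset (subset_univ _)).2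
            ⟨b₀, mem_univ _, notMem_erase _ _⟩)
        omega
      · obtain ⟨a, -, ha⟩ := hR.exists_ne hA a₀ b
        have h1 := hR W ⟨a, mem_enclosed.1 (hTW hb) a ha⟩ hWu
        have h2 := card_le_card hTW
        have h3 := pred_card_le_card_erase (s := W) (a := a₀)
        omega
    have hsub : W.erase a₀ ⊆ s.biUnion t := by
      intro a ha
      obtain ⟨hne, ha⟩ := mem_erase.1 ha
      obtain ⟨b, hb, ha⟩ := mem_biUnion.1 ha
      obtain ⟨hb₀, hb⟩ := mem_erase.1 hb
      refine mem_biUnion.2 ⟨b, hb, ?_⟩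
      simp only [t, if_neg hb₀, mem_erase]
      exact ⟨hne, ha⟩
    by_cases hb₀ : b₀ ∈ s
    · have h1 : insert a₀ (W.erase a₀) ⊆ s.biUnion t :=
        insert_subset (mem_biUnion.2 ⟨b₀, hb₀, by simp [t]⟩) hsub
      have h2 := card_le_card h1
      rw [card_insert_of_notMem (notMem_erase _ _)] at h2
      have h3 := card_erase_add_one hb₀
      rw [← hT] at h3
      omega
    · have hTs : T = s := by rw [hT, erase_eq_of_notMem hb₀]
      have := card_le_card hsub
      rw [hTs] at hTle
      omega
  obtain ⟨g, hg, hgt⟩ := (Finset.all_card_le_biUnion_card_iff_exists_injective t).1 hall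
  have hgR : ∀ b, R (g b) b := by
    intro b
    have := hgt b
    by_cases hb : b = b₀
    · simp only [t, if_pos hb, mem_singleton] at this
      rwa [this, hb]
    · simp only [t, if_neg hb, mem_erase, mem_filter] at this
      exact this.2.2
  have hbij : Function.Bijective g :=
    (Fintype.bijective_iff_injective_and_card g).2 ⟨hg, hAB.symm⟩
  refine ⟨(Equiv.ofBijective g hbij).symm, ?_, fun a => ?_⟩
  · rw [Equiv.symm_apply_eq]
    have := hgt b₀
    simp only [t, if_true, mem_singleton] at this
    exact this.symm
  · have := hgR ((Equiv.ofBijective g hbij).symm a)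
    rwa [show g ((Equiv.ofBijective g hbij).symm a) = a from
      (Equiv.ofBijective g hbij).apply_symm_apply a] at this

end StrictHall

/-! ### Bipartite matching covered graphs as relations between colour classes -/

variable {α β : Type*} {G : Graph α β} {X Y : Set α}

/-- The sets `X` and `Y` partition the vertices, and each edge has one end in each of them. -/
structure IsBipartition (G : Graph α β) (X Y : Set α) : Prop where
  union : X ∪ Y = V(G)
  disjoint : Disjoint X Y
  link : ∀ e x y, G.IsLink e x y → (x ∈ X ↔ y ∈ Y)

theorem IsBipartition.symm (h : G.IsBipartition X Y) : G.IsBipartition Y X :=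
  ⟨by rw [Set.union_comm, h.union], h.disjoint.symm, fun e x y hl => (h.link e y x hl.symm).symm⟩

theorem IsBipartite.exists_isBipartition (h : G.IsBipartite) : ∃ X Y, G.IsBipartition X Y := by
  obtain ⟨S, hS⟩ := h
  refine ⟨V(G) ∩ S, V(G) \ S, Set.inter_union_sdiff _ _, ?_, fun e x y hl => ?_⟩
  · rw [Set.disjoint_left]
    exact fun x hx hx' => hx'.2 hx.2
  · have := hS e x y hl
    exact ⟨fun hx => ⟨hl.right_mem, this.1 hx.2⟩, fun hy => ⟨hl.left_mem, this.2 hy.2⟩⟩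

theorem IsBipartition.deleteEdges (h : G.IsBipartition X Y) (F : Set β) :
    (G.deleteEdges F).IsBipartition X Y :=
  ⟨h.union, h.disjoint, fun e x y hl => h.link e x y (by simp at hl; exact hl.1)⟩

theorem IsBipartition.notMem_right (h : G.IsBipartition X Y) {x : α} (hx : x ∈ X) : x ∉ Y :=
  Set.disjoint_left.1 h.disjoint hx

theorem IsBipartition.mem_or_mem (h : G.IsBipartition X Y) {x : α} (hx : x ∈ V(G)) :
    x ∈ X ∨ x ∈ Y := by
  rwa [← h.union] at hx

theorem IsBipartition.left_mem (h : G.IsBipartition X Y) {x : α} (hx : x ∈ X) : x ∈ V(G) :=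
  h.union ▸ Or.inl hx

theorem IsBipartition.not_isLoopAt (h : G.IsBipartition X Y) (e : β) (x : α) :
    ¬ G.IsLoopAt e x := by
  intro hl
  have := h.link e x x hl
  rcases h.mem_or_mem hl.vertex_mem with hx | hx
  · exact h.notMem_right hx (this.1 hx)
  · exact h.notMem_right (this.2 hx) hx

theorem IsBipartition.exists_isLink (h : G.IsBipartition X Y) {e : β} (he : e ∈ E(G)) :
    ∃ x ∈ X, ∃ y ∈ Y, G.IsLink e x y := by
  obtain ⟨x, y, hl⟩ := exists_isLink_of_mem_edgeSet he
  rcases h.mem_or_mem hl.left_mem with hx | hx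
  · exact ⟨x, hx, y, (h.link _ _ _ hl).1 hx, hl⟩
  · exact ⟨y, (h.link _ _ _ hl.symm).2 hx, x, hx, hl.symm⟩

theorem IsBipartition.ncard_vertexSet (h : G.IsBipartition X Y) (hV : V(G).Finite) :
    V(G).ncard = X.ncard + Y.ncard := by
  rw [← h.union] at hV ⊢
  exact Set.ncard_union_eq h.disjoint (hV.subset Set.subset_union_left)
    (hV.subset Set.subset_union_right)

theorem IsBipartition.degree_eq (h : G.IsBipartition X Y) (x : α) :
    G.degree x = {e | G.Inc e x}.ncard := by
  have h1 : {e | G.IsLoopAt e x} = ∅ := by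
    ext e
    simp [h.not_isLoopAt e x]
  have h2 : {e | G.IsNonloopAt e x} = {e | G.Inc e x} := by
    ext e
    simp [isNonloopAt_iff_inc_not_isLoopAt, h.not_isLoopAt e x]
  rw [degree, h1, h2]
  simp

/-- Adjacency between the members of two sets of vertices. -/
def adjBetween (G : Graph α β) (X Y : Set α) (x : X) (y : Y) : Prop := G.Adj x y

theorem IsPerfectMatching.exists_equiv {M : Set β} (hM : G.IsPerfectMatching M)
    (h : G.IsBipartition X Y) :
    ∃ f : X ≃ Y, ∀ (x : X) (y : Y), f x = y ↔ ∃ e ∈ M, G.IsLink e x y := by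
  have key : ∀ X Y : Set α, G.IsBipartition X Y → ∀ x : X, ∃ y : Y, ∃ e ∈ M, G.IsLink e x y := by
    intro X Y h x
    obtain ⟨e, ⟨heM, y, hl⟩, -⟩ := hM.existsUnique x (h.left_mem x.2)
    exact ⟨⟨y, (h.link _ _ _ hl).1 x.2⟩, e, heM, hl⟩
  choose f hf using key X Y h
  choose g hg using key Y X h.symm
  have huniq : ∀ {z z' z'' : α}, (∃ e ∈ M, G.IsLink e z z') → (∃ e ∈ M, G.IsLink e z z'') →
      z' = z'' := by
    rintro z z' z'' ⟨e, he, hl⟩ ⟨e', he', hl'⟩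
    obtain rfl := (hM.existsUnique z hl.left_mem).unique ⟨he, hl.inc_left⟩ ⟨he', hl'.inc_left⟩
    exact hl.right_unique hl'
  have hswap : ∀ {z z' : α}, (∃ e ∈ M, G.IsLink e z z') → ∃ e ∈ M, G.IsLink e z' z :=
    fun ⟨e, he, hl⟩ => ⟨e, he, hl.symm⟩
  refine ⟨⟨f, g, fun x => Subtype.ext (huniq (hg (f x)) (hswap (hf x))),
    fun y => Subtype.ext (huniq (hf (g y)) (hswap (hg y)))⟩, fun x y => ⟨?_, fun h => ?_⟩⟩
  · rintro rfl
    exact hf x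
  · exact Subtype.ext (huniq (hf x) h)

theorem IsBipartition.isPerfectMatching_range (h : G.IsBipartition X Y) (f : X ≃ Y) (g : X → β)
    (hg : ∀ x, G.IsLink (g x) x (f x)) : G.IsPerfectMatching (Set.range g) where
  subset := by
    rintro _ ⟨x, rfl⟩
    exact (hg x).edge_mem
  not_isLoopAt e _ x := h.not_isLoopAt e x
  existsUnique := by
    intro z hz
    rcases h.mem_or_mem hz with hz | hz
    · refine ⟨g ⟨z, hz⟩, ⟨⟨_, rfl⟩, (hg ⟨z, hz⟩).inc_left⟩, ?_⟩
      rintro _ ⟨⟨x, rfl⟩, hi⟩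
      rcases hi.eq_or_eq_of_isLink (hg x) with rfl | rfl
      · rfl
      · exact absurd (f x).2 (h.notMem_right hz)
    · refine ⟨g (f.symm ⟨z, hz⟩), ⟨⟨_, rfl⟩, ?_⟩, ?_⟩
      · have := (hg (f.symm ⟨z, hz⟩)).inc_right
        rwa [f.apply_symm_apply] at this
      · rintro _ ⟨⟨x, rfl⟩, hi⟩
        rcases hi.eq_or_eq_of_isLink (hg x) with rfl | rfl
        · exact absurd hz (h.notMem_right x.2)
        · simp

section

open Finset Classical

variable [Fintype X]

theorem IsBipartition.ncard_edgeSet (h : G.IsBipartition X Y) (hE : E(G).Finite) :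
    E(G).ncard = ∑ x : X, G.degree x := by
  have hU : E(G) = ⋃ x : X, {e | G.Inc e x} := by
    ext e
    simp only [Set.mem_iUnion, Set.mem_ofPred_eq]
    refine ⟨fun he => ?_, fun ⟨x, hx⟩ => hx.edge_mem⟩
    obtain ⟨x, hx, y, hy, hl⟩ := h.exists_isLink he
    exact ⟨⟨x, hx⟩, hl.inc_left⟩
  have hfin : ∀ x : X, {e | G.Inc e x}.Finite := fun x => hE.subset fun e he => he.edge_mem
  rw [hU, Set.ncard_iUnion_of_finite hfin]
  · rw [finsum_eq_sum_of_fintype]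
    exact sum_congr rfl fun x _ => (h.degree_eq x).symm
  · intro x x' hne
    rw [Function.onFun, Set.disjoint_left]
    rintro e ⟨y, hl⟩ ⟨y', hl'⟩
    rcases hl.left_eq_or_eq hl' with hx | hx
    · exact hne (Subtype.ext hx)
    · exact h.notMem_right x.2 (hx ▸ (h.link _ _ _ hl').1 x'.2)

variable [Fintype Y]

theorem IsMatchingCovered.exists_edge (hG : G.IsMatchingCovered) (x : α) (hx : x ∈ V(G)) :
    ∃ e, G.Inc e x := by
  obtain ⟨y, hy, hne⟩ : ∃ y ∈ V(G), y ≠ x := by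
    by_contra! hcon
    have : V(G) ⊆ {x} := fun y hy => hcon y hy
    have := Set.ncard_le_ncard this
    have := hG.four_le
    simp at *
    omega
  rcases (hG.connected.2 x hx y hy).cases_head with rfl | ⟨z, ⟨e, hl⟩, -⟩
  · exact absurd rfl hne
  · exact ⟨e, hl.inc_left⟩

theorem IsMatchingCovered.card_eq (hG : G.IsMatchingCovered) (h : G.IsBipartition X Y) :
    Fintype.card X = Fintype.card Y := by
  obtain ⟨x, hx⟩ := hG.connected.1
  obtain ⟨e, he⟩ := hG.exists_edge x hx
  obtain ⟨M, hM, -⟩ := hG.exists_perfectMatching e he.edge_mem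
  obtain ⟨f, -⟩ := hM.exists_equiv h
  exact Fintype.card_congr f

theorem IsBipartition.ncard_eq (h : G.IsBipartition X Y) :
    V(G).ncard = Fintype.card X + Fintype.card Y := by
  rw [h.ncard_vertexSet (h.union ▸ (Set.toFinite X).union (Set.toFinite Y)),
    ← Nat.card_coe_set_eq, ← Nat.card_coe_set_eq, Nat.card_eq_fintype_card, Nat.card_eq_fintype_card]

theorem IsMatchingCovered.two_le_card (hG : G.IsMatchingCovered) (h : G.IsBipartition X Y) :
    2 ≤ Fintype.card X := by
  have h1 := hG.card_eq h
  have h2 := hG.four_le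
  rw [h.ncard_eq] at h2
  omega

/-- By connectivity some edge joins `Z` to a vertex not enclosed by it. A perfect matching through
that edge maps the enclosed vertices injectively into `Z` minus one vertex. -/
theorem IsMatchingCovered.strictHall (hG : G.IsMatchingCovered) (h : G.IsBipartition X Y) :
    StrictHall (G.adjBetween X Y) := by
  intro Z ⟨z, hz⟩ hZu
  obtain ⟨w, hw⟩ : ∃ w, w ∉ Z := by
    by_contra! hcon
    exact hZu (eq_univ_iff_forall.2 hcon)
  let Q : Set α := {u | ∃ hu : u ∈ X, (⟨u, hu⟩ : X) ∈ Z} ∪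
    {u | ∃ hu : u ∈ Y, (⟨u, hu⟩ : Y) ∈ enclosed (G.adjBetween X Y) Z}
  -- an edge leaves `Z` and the vertices that it encloses
  obtain ⟨x, hxZ, y, hyZ, e, hl⟩ : ∃ x ∈ Z, ∃ y ∉ enclosed (G.adjBetween X Y) Z,
      ∃ e, G.IsLink e x y := by
    by_contra! hcon
    have hstep : ∀ u, Relation.ReflTransGen G.Adj z u → u ∈ Q := by
      intro u hu
      induction hu with
      | refl => exact Or.inl ⟨z.2, hz⟩
      | @tail u v _ huv ih =>
        obtain ⟨e, hl⟩ := huv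
        rcases ih with ⟨hu, huZ⟩ | ⟨hu, huZ⟩
        · have hv := (h.link _ _ _ hl).1 hu
          by_contra hvQ
          exact hcon ⟨u, hu⟩ huZ ⟨v, hv⟩ (fun hve => hvQ (Or.inr ⟨hv, hve⟩)) e hl
        · have hv := (h.link _ _ _ hl.symm).2 hu
          exact Or.inl ⟨hv, mem_enclosed.1 huZ ⟨v, hv⟩ ⟨e, hl.symm⟩⟩
    rcases hstep w (hG.connected.2 z (h.left_mem z.2) w (h.left_mem w.2)) with ⟨_, hwZ⟩ | ⟨hwY, -⟩
    · exact hw hwZ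
    · exact h.notMem_right w.2 hwY
  obtain ⟨M, hM, heM⟩ := hG.exists_perfectMatching e hl.edge_mem
  obtain ⟨f, hf⟩ := hM.exists_equiv h
  have hfx : f x = y := (hf x y).2 ⟨e, heM, hl⟩
  have hsub : (enclosed (G.adjBetween X Y) Z).image f.symm ⊆ Z.erase x := by
    intro a ha
    obtain ⟨b, hb, rfl⟩ := mem_image.1 ha
    rw [mem_erase]
    constructor
    · rintro rfl
      rw [f.apply_symm_apply] at hfx
      exact hyZ (hfx ▸ hb)
    · obtain ⟨e', -, hl'⟩ := (hf (f.symm b) b).1 (f.apply_symm_apply b)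
      exact mem_enclosed.1 hb _ ⟨e', hl'⟩
  have := card_le_card hsub
  rw [card_image_of_injective _ f.symm.injective] at this
  have h2 := card_erase_add_one hxZ
  omega

/-- Connectivity holds because the part of `X` in a component and its complement would together
enclose all of `Y`, losing one vertex each. The matchings come from `StrictHall.exists_equiv`. -/
theorem IsBipartition.isMatchingCovered (h : G.IsBipartition X Y)
    (hXY : Fintype.card X = Fintype.card Y) (hX : 2 ≤ Fintype.card X)
    (hR : StrictHall (G.adjBetween X Y)) : G.IsMatchingCovered where
  connected := by
    obtain ⟨x₀⟩ : Nonempty X := Fintype.card_pos_iff.1 (by omega)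
    refine ⟨⟨x₀, h.left_mem x₀.2⟩, fun x hx => ?_⟩
    have hnb : ∀ y ∈ Y, ∃ x ∈ X, G.Adj y x := by
      intro y hy
      obtain ⟨a, -, ha⟩ := hR.exists_ne hX x₀ ⟨y, hy⟩
      exact ⟨a, a.2, Adj.symm ha⟩
    set Z : Finset X := univ.filter fun a => Relation.ReflTransGen G.Adj x a with hZ
    have hZne : Z.Nonempty := by
      rcases h.mem_or_mem hx with hx | hx
      · exact ⟨⟨x, hx⟩, by simp [hZ, Relation.ReflTransGen.refl]⟩
      · obtain ⟨a, ha, hadj⟩ := hnb x hx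
        exact ⟨⟨a, ha⟩, by simpa [hZ] using Relation.ReflTransGen.single hadj⟩
    have hZu : Z = univ := by
      by_contra hZu
      have h1 := hR Z hZne hZu
      have h2 := hR Zᶜ (by rwa [nonempty_iff_ne_empty, ne_eq, compl_eq_empty_iff])
        (by rw [ne_eq, compl_eq_univ_iff]; exact hZne.ne_empty)
      have hcov : (univ : Finset Y) ⊆
          enclosed (G.adjBetween X Y) Z ∪ enclosed (G.adjBetween X Y) Zᶜ := by
        intro y _
        rw [mem_union, mem_enclosed, mem_enclosed]
        by_cases hy : Relation.ReflTransGen G.Adj x y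
        · exact Or.inl fun a ha => mem_filter.2 ⟨mem_univ _, hy.tail (Adj.symm ha)⟩
        · refine Or.inr fun a ha => ?_
          rw [mem_compl]
          exact fun haZ => hy ((mem_filter.1 haZ).2.tail ha)
      have h3 := (card_le_card hcov).trans (card_union_le _ _)
      have h4 := card_add_card_compl Z
      rw [card_univ] at h3
      omega
    have hreach : ∀ a ∈ X, Relation.ReflTransGen G.Adj x a := by
      intro a ha
      have : (⟨a, ha⟩ : X) ∈ Z := hZu ▸ mem_univ _
      exact (mem_filter.1 this).2
    intro y hy
    rcases h.mem_or_mem hy with hy | hy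
    · exact hreach y hy
    · obtain ⟨a, ha, hadj⟩ := hnb y hy
      exact (hreach a ha).tail hadj.symm
  four_le := by
    rw [h.ncard_eq]
    omega
  exists_perfectMatching := by
    intro e he
    obtain ⟨x, hx, y, hy, hl⟩ := h.exists_isLink he
    obtain ⟨f, hf, hfR⟩ := hR.exists_equiv hXY hX
      (show G.adjBetween X Y ⟨x, hx⟩ ⟨y, hy⟩ from ⟨e, hl⟩)
    have hg : ∀ a : X, ∃ e', G.IsLink e' a (f a) ∧ (a = ⟨x, hx⟩ → e' = e) := by
      intro a
      by_cases ha : a = ⟨x, hx⟩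
      · exact ⟨e, by rw [ha, hf]; exact hl, fun _ => rfl⟩
      · obtain ⟨e', he'⟩ := hfR a
        exact ⟨e', he', fun h => absurd h ha⟩
    choose g hg hge using hg
    exact ⟨Set.range g, h.isPerfectMatching_range f g hg, ⟨⟨x, hx⟩, hge _ rfl⟩⟩

/-- An edge of a minimal bipartite matching covered graph has a barrier, and no parallel edge. -/
theorem IsMinimalBipartiteMatchingCovered.exists_isBarrier
    (hG : G.IsMinimalBipartiteMatchingCovered) (h : G.IsBipartition X Y) {e : β} {x : X} {y : Y}
    (hl : G.IsLink e x y) :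
    (∃ Z, IsBarrier (G.adjBetween X Y) x y Z) ∧ ∀ e', G.IsLink e' x y → e' = e := by
  have hR := hG.matchingCovered.strictHall h
  have hnot : ¬ StrictHall ((G.deleteEdges {e}).adjBetween X Y) := fun hS =>
    hG.minimal e hl.edge_mem ((h.deleteEdges {e}).isMatchingCovered
      (hG.matchingCovered.card_eq h) (hG.matchingCovered.two_le_card h) hS)
  simp only [StrictHall, not_forall, not_lt] at hnot
  obtain ⟨Z, hZ, hZu, hle⟩ := hnot
  have hlt := hR Z hZ hZu
  have hdel : ∀ a b e', G.IsLink e' a b → e' ≠ e → (G.deleteEdges {e}).Adj a b :=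
    fun a b e' hl' hne => ⟨e', by simp [hl', hne]⟩
  -- Deleting `e` can newly enclose only `y`. Since the strict inequality fails after the deletion,
  -- `y` is indeed gained and `Z` was tight before.
  have hsub : enclosed ((G.deleteEdges {e}).adjBetween X Y) Z ⊆
      insert y (enclosed (G.adjBetween X Y) Z) := by
    intro b hb
    rw [mem_insert, mem_enclosed]
    by_cases hby : b = y
    · exact Or.inl hby
    · right
      rintro a ⟨e', hl'⟩
      refine mem_enclosed.1 hb a (hdel _ _ _ hl' ?_)
      rintro rfl
      rcases hl'.right_eq_or_eq hl with hx | hy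
      · exact h.notMem_right x.2 (hx ▸ b.2)
      · exact hby (Subtype.ext hy)
  have hy : y ∉ enclosed (G.adjBetween X Y) Z := by
    intro hy
    rw [insert_eq_of_mem hy] at hsub
    have := card_le_card hsub
    omega
  have hy' : y ∈ enclosed ((G.deleteEdges {e}).adjBetween X Y) Z := by
    by_contra hy'
    have : enclosed ((G.deleteEdges {e}).adjBetween X Y) Z ⊆ enclosed (G.adjBetween X Y) Z :=
      fun b hb => (mem_insert.1 (hsub hb)).resolve_left fun hby => hy' (hby ▸ hb)
    have := card_le_card this
    omega
  have hc := card_le_card hsub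
  rw [card_insert_of_notMem hy] at hc
  have hmem : ∀ (a : X) e', G.IsLink e' a y → e' ≠ e → a ∈ Z := fun a e' hl' hne =>
    mem_enclosed.1 hy' a (hdel _ _ _ hl' hne)
  have hx : x ∉ Z := by
    intro hx
    refine hy (mem_enclosed.2 ?_)
    rintro a ⟨e', hl'⟩
    by_cases hee : e' = e
    · subst hee
      have : a = x := Subtype.ext (hl'.left_unique hl)
      exact this ▸ hx
    · exact hmem a e' hl' hee
  refine ⟨⟨Z, hx, ?_, hZ, by omega⟩, fun e' hl' => ?_⟩
  · rintro a ⟨e', hl'⟩ hne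
    refine hmem a e' hl' ?_
    rintro rfl
    exact hne (Subtype.ext (hl'.left_unique hl))
  · by_contra hne
    exact hx (hmem x e' hl' hne)

theorem IsMinimalBipartiteMatchingCovered.degree_eq_card
    (hG : G.IsMinimalBipartiteMatchingCovered) (h : G.IsBipartition X Y) (x : X) :
    G.degree x = (univ.filter (G.adjBetween X Y x)).card := by
  rw [h.degree_eq, ← Set.ncard_coe_finset]
  refine Set.ncard_congr (fun e he => ⟨he.choose, (h.link _ _ _ he.choose_spec).1 x.2⟩) ?_ ?_ ?_
  · intro e he
    simp only [coe_filter, mem_univ, true_and, Set.mem_ofPred_eq]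
    exact ⟨e, he.choose_spec⟩
  · intro e e' he he' heq
    have h1 := he.choose_spec
    have h2 := he'.choose_spec
    have h3 : he.choose = he'.choose := congrArg Subtype.val heq
    rw [← h3] at h2
    exact ((hG.exists_isBarrier h (y := ⟨_, (h.link _ _ _ h1).1 x.2⟩) h1).2 e' h2).symm
  · intro y hy
    simp only [coe_filter, mem_univ, true_and, Set.mem_ofPred_eq] at hy
    obtain ⟨e, hl⟩ := hy
    exact ⟨e, ⟨y, hl⟩, Subtype.ext ((Exists.choose_spec (⟨y, hl⟩ : G.Inc e x)).right_unique hl)⟩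

theorem IsMinimalBipartiteMatchingCovered.ncard_edgeSet_add_two_le
    (hG : G.IsMinimalBipartiteMatchingCovered) (h : G.IsBipartition X Y) (hE : E(G).Finite) :
    E(G).ncard + 2 ≤ V(G).ncard + {x ∈ X | G.degree x = 2}.ncard := by
  have hXY := hG.matchingCovered.card_eq h
  have key := (hG.matchingCovered.strictHall h).card_pairs_add_two_le hXY
    (hG.matchingCovered.two_le_card h) (fun x y ⟨e, hl⟩ => (hG.exists_isBarrier h hl).1)
  simp only [← hG.degree_eq_card h] at key
  rw [← h.ncard_edgeSet hE] at key
  rw [h.ncard_eq, ← hXY, ← two_mul]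
  refine key.trans_eq ?_
  congr 1
  rw [← Set.ncard_coe_finset, ← Set.ncard_image_of_injective _ Subtype.val_injective]
  congr 1
  ext x
  simp [and_comm]

end

/-- A lower bound for the number of vertices of degree two. -/
theorem IsMinimalBipartiteMatchingCovered.two_mul_le_ncard_twoVertices
    (hG : G.IsMinimalBipartiteMatchingCovered) (hV : V(G).Finite) (hE : E(G).Finite) :
    2 * E(G).ncard + 4 ≤ 2 * V(G).ncard + G.twoVertices.ncard := by
  obtain ⟨X, Y, h⟩ := hG.bipartite.exists_isBipartition
  have hX : X.Finite := hV.subset (h.union ▸ Set.subset_union_left)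
  have hY : Y.Finite := hV.subset (h.union ▸ Set.subset_union_right)
  have := hX.fintype
  have := hY.fintype
  have h1 := hG.ncard_edgeSet_add_two_le h hE
  have h2 := hG.ncard_edgeSet_add_two_le h.symm hE
  have h3 : G.twoVertices = {x ∈ X | G.degree x = 2} ∪ {x ∈ Y | G.degree x = 2} := by
    ext x
    simp only [twoVertices, ← h.union, Set.mem_ofPred_eq, Set.mem_union]
    tauto
  have h4 : G.twoVertices.ncard = _ := h3 ▸ Set.ncard_union_eq
    (h.disjoint.mono (Set.sep_subset _ _) (Set.sep_subset _ _))
    (hX.subset (Set.sep_subset _ _)) (hY.subset (Set.sep_subset _ _))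
  omega

end Graph

/-! ### Contracting the two edges at a vertex of degree 2 -/

namespace Graph

variable {α β : Type*} {G : Graph α β} {v v₁ v₂ : α} {e₁ e₂ : β}

/-- The vertex `v` is incident with no edges but `e₁` and `e₂`,
which join it to distinct vertices `v₁` and `v₂`. -/
structure IsBicontractible (G : Graph α β) (v v₁ v₂ : α) (e₁ e₂ : β) : Prop where
  link₁ : G.IsLink e₁ v v₁
  link₂ : G.IsLink e₂ v v₂
  ne : v₁ ≠ v₂
  ne₁ : v ≠ v₁
  ne₂ : v ≠ v₂
  inc : ∀ e, G.Inc e v → e = e₁ ∨ e = e₂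

open Classical in
/-- The map on vertices that underlies `contractPair`. -/
noncomputable def collapse (v v₁ v₂ x : α) : α := if x = v₁ ∨ x = v₂ then v else x

theorem collapse_of_ne {x : α} (h₁ : x ≠ v₁) (h₂ : x ≠ v₂) : collapse v v₁ v₂ x = x := by
  simp [collapse, h₁, h₂]

theorem collapse_left : collapse v v₁ v₂ v₁ = v := by simp [collapse]

theorem collapse_right : collapse v v₁ v₂ v₂ = v := by simp [collapse]

theorem collapse_eq_self_iff {x : α} : collapse v v₁ v₂ x = v ↔ x = v ∨ x = v₁ ∨ x = v₂ := by
  unfold collapse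
  split_ifs <;> tauto

theorem collapse_eq_iff_of_ne {x z : α} (hz : z ≠ v) :
    collapse v v₁ v₂ x = z ↔ x = z ∧ z ≠ v₁ ∧ z ≠ v₂ := by
  unfold collapse
  split_ifs with h
  · constructor
    · exact fun h => absurd h.symm hz
    · rintro ⟨rfl, h1, h2⟩
      tauto
  · constructor
    · rintro rfl
      tauto
    · exact fun h => h.1

theorem contractPair_isLink {e : β} {x y : α} :
    (G.contractPair v v₁ v₂ e₁ e₂).IsLink e x y ↔ e ≠ e₁ ∧ e ≠ e₂ ∧
      ∃ x' y', G.IsLink e x' y' ∧ collapse v v₁ v₂ x' = x ∧ collapse v v₁ v₂ y' = y := by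
  simp only [contractPair, map_isLink, Relation.Map, deleteEdges_isLink, Set.mem_insert_iff,
    Set.mem_singleton_iff, not_or, collapse]
  grind

theorem contractPair_inc {e : β} {x : α} :
    (G.contractPair v v₁ v₂ e₁ e₂).Inc e x ↔ e ≠ e₁ ∧ e ≠ e₂ ∧
      ∃ x', G.Inc e x' ∧ collapse v v₁ v₂ x' = x := by
  simp only [Inc, contractPair_isLink]
  grind

theorem edgeSet_contractPair :
    E(G.contractPair v v₁ v₂ e₁ e₂) = E(G) \ {e₁, e₂} := by
  simp [contractPair]

theorem contractPair_comm :
    G.contractPair v v₁ v₂ e₁ e₂ = G.contractPair v v₂ v₁ e₂ e₁ := by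
  unfold contractPair
  rw [Set.pair_comm]
  congr 1
  funext x
  split_ifs <;> tauto

/-- This commutation lets minimality, a statement about deletions, be carried through contraction.
-/
theorem contractPair_deleteEdges (e : β) :
    (G.deleteEdges {e}).contractPair v v₁ v₂ e₁ e₂ =
      (G.contractPair v v₁ v₂ e₁ e₂).deleteEdges {e} := by
  refine Graph.ext (by simp [contractPair]) fun f x y => ?_
  simp only [deleteEdges_isLink, contractPair_isLink]
  grind

namespace IsBicontractible

theorem symm (h : G.IsBicontractible v v₁ v₂ e₁ e₂) : G.IsBicontractible v v₂ v₁ e₂ e₁ :=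
  ⟨h.link₂, h.link₁, h.ne.symm, h.ne₂, h.ne₁, fun e he => (h.inc e he).symm⟩

theorem edge_ne (h : G.IsBicontractible v v₁ v₂ e₁ e₂) : e₁ ≠ e₂ := by
  rintro rfl
  exact h.ne (h.link₁.right_unique h.link₂)

theorem inc₁ (h : G.IsBicontractible v v₁ v₂ e₁ e₂) {x : α} (hx : G.Inc e₁ x) : x = v ∨ x = v₁ :=
  hx.eq_or_eq_of_isLink h.link₁

theorem inc₂ (h : G.IsBicontractible v v₁ v₂ e₁ e₂) {x : α} (hx : G.Inc e₂ x) : x = v ∨ x = v₂ :=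
  hx.eq_or_eq_of_isLink h.link₂

theorem deleteEdges (h : G.IsBicontractible v v₁ v₂ e₁ e₂) {e : β} (h₁ : e ≠ e₁) (h₂ : e ≠ e₂) :
    (G.deleteEdges {e}).IsBicontractible v v₁ v₂ e₁ e₂ :=
  ⟨by simp [h.link₁, h₁.symm], by simp [h.link₂, h₂.symm], h.ne, h.ne₁, h.ne₂,
    fun f hf => h.inc f (deleteEdges_inc.1 hf).1⟩

theorem vertexSet_contractPair (h : G.IsBicontractible v v₁ v₂ e₁ e₂) :
    V(G.contractPair v v₁ v₂ e₁ e₂) = V(G) \ {v₁, v₂} := by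
  have hV : V(G.contractPair v v₁ v₂ e₁ e₂) = collapse v v₁ v₂ '' V(G) := rfl
  rw [hV]
  ext x
  simp only [Set.mem_image, Set.mem_sdiff, Set.mem_insert_iff, Set.mem_singleton_iff, not_or]
  constructor
  · rintro ⟨y, hy, rfl⟩
    by_cases hyv : collapse v v₁ v₂ y = v
    · rw [hyv]
      exact ⟨h.link₁.left_mem, h.ne₁, h.ne₂⟩
    · obtain ⟨h1, h2, h3⟩ := (collapse_eq_iff_of_ne hyv).1 rfl
      exact ⟨h1 ▸ hy, h2, h3⟩
  · rintro ⟨hx, h1, h2⟩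
    exact ⟨x, hx, collapse_of_ne h1 h2⟩

theorem ncard_vertexSet (h : G.IsBicontractible v v₁ v₂ e₁ e₂) (hV : V(G).Finite) :
    V(G.contractPair v v₁ v₂ e₁ e₂).ncard + 2 = V(G).ncard := by
  rw [h.vertexSet_contractPair, ← Set.ncard_pair h.ne]
  refine Set.ncard_sdiff_add_ncard_of_subset ?_ hV
  rintro x (rfl | rfl)
  · exact h.link₁.right_mem
  · exact h.link₂.right_mem

theorem ncard_edgeSet (h : G.IsBicontractible v v₁ v₂ e₁ e₂) (hE : E(G).Finite) :
    E(G.contractPair v v₁ v₂ e₁ e₂).ncard + 2 = E(G).ncard := by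
  rw [edgeSet_contractPair, ← Set.ncard_pair h.edge_ne]
  refine Set.ncard_sdiff_add_ncard_of_subset ?_ hE
  rintro x (rfl | rfl)
  · exact h.link₁.edge_mem
  · exact h.link₂.edge_mem

theorem contractPair_inc_self (h : G.IsBicontractible v v₁ v₂ e₁ e₂) {e : β} :
    (G.contractPair v v₁ v₂ e₁ e₂).Inc e v ↔
      e ≠ e₁ ∧ e ≠ e₂ ∧ (G.Inc e v₁ ∨ G.Inc e v₂) := by
  rw [contractPair_inc]
  refine and_congr_right fun h1 => and_congr_right fun h2 => ⟨?_, ?_⟩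
  · rintro ⟨x, hx, hxv⟩
    rcases collapse_eq_self_iff.1 hxv with rfl | rfl | rfl
    · exact absurd (h.inc e hx) (by tauto)
    · exact Or.inl hx
    · exact Or.inr hx
  · rintro (hx | hx)
    · exact ⟨_, hx, collapse_left⟩
    · exact ⟨_, hx, collapse_right⟩

theorem contractPair_inc_of_ne (h : G.IsBicontractible v v₁ v₂ e₁ e₂) {e : β} {x : α}
    (hv : x ≠ v) (h₁ : x ≠ v₁) (h₂ : x ≠ v₂) :
    (G.contractPair v v₁ v₂ e₁ e₂).Inc e x ↔ G.Inc e x := by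
  rw [contractPair_inc]
  constructor
  · rintro ⟨-, -, y, hy, hyx⟩
    rwa [((collapse_eq_iff_of_ne hv).1 hyx).1] at hy
  · intro hx
    refine ⟨?_, ?_, x, hx, collapse_of_ne h₁ h₂⟩
    · rintro rfl
      exact (h.inc₁ hx).elim hv h₁
    · rintro rfl
      exact (h.inc₂ hx).elim hv h₂

/-- A perfect matching uses exactly one of `e₁`, `e₂`. Once it is dropped, the merged vertex stays
covered through the other neighbour of `v`. -/
theorem isPerfectMatching_contractPair (h : G.IsBicontractible v v₁ v₂ e₁ e₂)
    (hadj : ¬ G.Adj v₁ v₂) {M : Set β} (hM : G.IsPerfectMatching M) :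
    (G.contractPair v v₁ v₂ e₁ e₂).IsPerfectMatching (M \ {e₁, e₂}) where
  subset := by
    rw [edgeSet_contractPair]
    exact Set.sdiff_subset_sdiff_left hM.subset
  not_isLoopAt := by
    rintro e ⟨heM, -⟩ x hl
    obtain ⟨h1, h2, x', y', hl', hx', hy'⟩ := contractPair_isLink.1 hl
    have hne : x' ≠ y' := fun hxy => hM.not_isLoopAt e heM x' (by rw [← hxy] at hl'; exact hl')
    have hv : ∀ z, G.Inc e z → z ≠ v := by
      rintro z hz rfl
      exact (h.inc e hz).elim h1 h2
    by_cases hxv : x = v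
    · subst hxv
      have hx1 := (collapse_eq_self_iff.1 hx').resolve_left (hv _ hl'.inc_left)
      have hy1 := (collapse_eq_self_iff.1 hy').resolve_left (hv _ hl'.inc_right)
      rcases hx1 with rfl | rfl <;> rcases hy1 with rfl | rfl
      · exact hne rfl
      · exact hadj ⟨e, hl'⟩
      · exact hadj ⟨e, hl'.symm⟩
      · exact hne rfl
    · exact hne (((collapse_eq_iff_of_ne hxv).1 hx').1.trans
        ((collapse_eq_iff_of_ne hxv).1 hy').1.symm)
  existsUnique := by
    intro x hx
    rw [h.vertexSet_contractPair] at hx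
    obtain ⟨hxV, hx12⟩ := hx
    simp only [Set.mem_insert_iff, Set.mem_singleton_iff, not_or] at hx12
    by_cases hxv : x = v
    · subst hxv
      have key : ∀ {w₁ w₂ f₁ f₂}, G.IsBicontractible x w₁ w₂ f₁ f₂ → f₁ ∈ M →
          ∃! e, e ∈ M \ {f₁, f₂} ∧ (G.contractPair x w₁ w₂ f₁ f₂).Inc e x := by
        intro w₁ w₂ f₁ f₂ h hf₁
        obtain ⟨g, ⟨hgM, hg⟩, -⟩ := hM.existsUnique w₂ h.link₂.right_mem
        have hg₁ : g ≠ f₁ := by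
          rintro rfl
          exact (h.inc₁ hg).elim h.ne₂.symm h.ne.symm
        have hg₂ : g ≠ f₂ := by
          rintro rfl
          exact hg₁ ((hM.existsUnique x hxV).unique ⟨hgM, h.link₂.inc_left⟩
            ⟨hf₁, h.link₁.inc_left⟩)
        refine ⟨g, ⟨⟨hgM, by simp [hg₁, hg₂]⟩, h.contractPair_inc_self.2 ⟨hg₁, hg₂, Or.inr hg⟩⟩, ?_⟩
        rintro g' ⟨⟨hg'M, -⟩, hg'⟩
        obtain ⟨hg'₁, hg'₂, hi | hi⟩ := h.contractPair_inc_self.1 hg'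
        · exact absurd ((hM.existsUnique w₁ hi.vertex_mem).unique ⟨hg'M, hi⟩
            ⟨hf₁, h.link₁.inc_right⟩) hg'₁
        · exact (hM.existsUnique w₂ hi.vertex_mem).unique ⟨hg'M, hi⟩ ⟨hgM, hg⟩
      obtain ⟨f, ⟨hfM, hf⟩, -⟩ := hM.existsUnique x hxV
      rcases h.inc f hf with rfl | rfl
      · exact key h hfM
      · rw [contractPair_comm, Set.pair_comm]
        exact key h.symm hfM
    · obtain ⟨f, ⟨hfM, hf⟩, hfu⟩ := hM.existsUnique x hxV
      have hi := fun e => h.contractPair_inc_of_ne (e := e) hxv hx12.1 hx12.2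
      have hf' := (hi f).2 hf
      have := contractPair_inc.1 hf'
      refine ⟨f, ⟨⟨hfM, by simp [this.1, this.2.1]⟩, hf'⟩, ?_⟩
      rintro g ⟨⟨hgM, -⟩, hg⟩
      exact hfu g ⟨hgM, (hi g).1 hg⟩

/-- The edge at the merged vertex lifts to one at `v₁`, leaving exactly `v` and `v₂` uncovered; `e₂`
joins them. -/
theorem isPerfectMatching_insert (h : G.IsBicontractible v v₁ v₂ e₁ e₂) {M : Set β}
    (hM : (G.contractPair v v₁ v₂ e₁ e₂).IsPerfectMatching M) {f : β} (hf : f ∈ M)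
    (hfv : G.Inc f v₁) : G.IsPerfectMatching (insert e₂ M) := by
  have hME : ∀ e ∈ M, e ∈ E(G) ∧ e ≠ e₁ ∧ e ≠ e₂ := by
    intro e he
    have := hM.subset he
    rw [edgeSet_contractPair] at this
    simpa using this
  have hfself : (G.contractPair v v₁ v₂ e₁ e₂).Inc f v :=
    h.contractPair_inc_self.2 ⟨(hME f hf).2.1, (hME f hf).2.2, Or.inl hfv⟩
  have hvV : v ∈ V(G.contractPair v v₁ v₂ e₁ e₂) := hfself.vertex_mem
  have hfu : ∀ g ∈ M, G.Inc g v₁ ∨ G.Inc g v₂ → g = f := fun g hg hi =>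
    (hM.existsUnique v hvV).unique
      ⟨hg, h.contractPair_inc_self.2 ⟨(hME g hg).2.1, (hME g hg).2.2, hi⟩⟩ ⟨hf, hfself⟩
  -- Otherwise `f` would become a loop in the contraction.
  have hfv₂ : ¬ G.Inc f v₂ := by
    intro hi
    obtain ⟨w, hl⟩ := hfv
    obtain rfl := hi.eq_of_isLink_of_ne_left hl h.ne.symm
    exact hM.not_isLoopAt f hf v (contractPair_isLink.2
      ⟨(hME f hf).2.1, (hME f hf).2.2, _, _, hl, collapse_left, collapse_right⟩)
  constructor
  · rintro e (rfl | he)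
    · exact h.link₂.edge_mem
    · exact (hME e he).1
  · rintro e (rfl | he) x hl
    · have hv := hl.eq_of_inc h.link₂.inc_left
      have hv₂ := hl.eq_of_inc h.link₂.inc_right
      exact h.ne₂ (hv.symm.trans hv₂)
    · exact hM.not_isLoopAt e he _ (contractPair_isLink.2
        ⟨(hME e he).2.1, (hME e he).2.2, _, _, hl, rfl, rfl⟩)
  · intro x hx
    by_cases hxv : x = v
    · subst hxv
      refine ⟨e₂, ⟨Or.inl rfl, h.link₂.inc_left⟩, ?_⟩
      rintro g ⟨rfl | hg, hi⟩
      · rfl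
      · exact (h.inc g hi).resolve_left (hME g hg).2.1
    by_cases hx₁ : x = v₁
    · subst hx₁
      refine ⟨f, ⟨Or.inr hf, hfv⟩, ?_⟩
      rintro g ⟨rfl | hg, hi⟩
      · exact ((h.inc₂ hi).elim h.ne₁.symm h.ne).elim
      · exact hfu g hg (Or.inl hi)
    by_cases hx₂ : x = v₂
    · subst hx₂
      refine ⟨e₂, ⟨Or.inl rfl, h.link₂.inc_right⟩, ?_⟩
      rintro g ⟨rfl | hg, hi⟩
      · rfl
      · obtain rfl := hfu g hg (Or.inr hi)
        exact absurd hi hfv₂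
    have hi := fun e => h.contractPair_inc_of_ne (e := e) hxv hx₁ hx₂
    obtain ⟨g, ⟨hgM, hg⟩, hgu⟩ := hM.existsUnique x (by
      rw [h.vertexSet_contractPair]
      exact ⟨hx, by simp [hx₁, hx₂]⟩)
    refine ⟨g, ⟨Or.inr hgM, (hi g).1 hg⟩, ?_⟩
    rintro g' ⟨rfl | hg', hi'⟩
    · exact ((h.inc₂ hi').elim hxv hx₂).elim
    · exact hgu g' ⟨hg', (hi g').2 hi'⟩

theorem isConnected_contractPair (h : G.IsBicontractible v v₁ v₂ e₁ e₂) (hG : G.IsConnected) :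
    (G.contractPair v v₁ v₂ e₁ e₂).IsConnected := by
  have hlift : ∀ x y, Relation.ReflTransGen G.Adj x y →
      Relation.ReflTransGen (G.contractPair v v₁ v₂ e₁ e₂).Adj
        (collapse v v₁ v₂ x) (collapse v v₁ v₂ y) := by
    intro x y hxy
    induction hxy with
    | refl => exact .refl
    | @tail y z _ hyz ih =>
      obtain ⟨e, hl⟩ := hyz
      by_cases he : e = e₁ ∨ e = e₂
      · have hall : ∀ w, G.Inc e w → collapse v v₁ v₂ w = v := by
          intro w hw
          rw [collapse_eq_self_iff]
          rcases he with rfl | rfl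
          · exact (h.inc₁ hw).imp_right Or.inl
          · exact (h.inc₂ hw).imp_right Or.inr
        rw [hall y hl.inc_left] at ih
        rwa [hall z hl.inc_right]
      · rw [not_or] at he
        exact ih.tail ⟨e, contractPair_isLink.2 ⟨he.1, he.2, _, _, hl, rfl, rfl⟩⟩
  refine ⟨⟨v, ?_⟩, fun x hx y hy => ?_⟩
  · rw [h.vertexSet_contractPair]
    exact ⟨h.link₁.left_mem, by simp [h.ne₁, h.ne₂]⟩
  · rw [h.vertexSet_contractPair] at hx hy
    have hx' := hx.2
    have hy' := hy.2
    simp only [Set.mem_insert_iff, Set.mem_singleton_iff, not_or] at hx' hy'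
    have := hlift x y (hG.2 x hx.1 y hy.1)
    rwa [collapse_of_ne hx'.1 hx'.2, collapse_of_ne hy'.1 hy'.2] at this

theorem isConnected_of_contractPair (h : G.IsBicontractible v v₁ v₂ e₁ e₂)
    (hG : (G.contractPair v v₁ v₂ e₁ e₂).IsConnected) : G.IsConnected := by
  have hcol : ∀ x, Relation.ReflTransGen G.Adj x (collapse v v₁ v₂ x) ∧
      Relation.ReflTransGen G.Adj (collapse v v₁ v₂ x) x := by
    intro x
    by_cases hx : collapse v v₁ v₂ x = v
    · rw [hx]
      rcases collapse_eq_self_iff.1 hx with rfl | rfl | rfl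
      · exact ⟨.refl, .refl⟩
      · exact ⟨.single h.link₁.symm.adj, .single h.link₁.adj⟩
      · exact ⟨.single h.link₂.symm.adj, .single h.link₂.adj⟩
    · rw [← ((collapse_eq_iff_of_ne hx).1 rfl).1]
      exact ⟨.refl, .refl⟩
  have hdown : ∀ x y, Relation.ReflTransGen (G.contractPair v v₁ v₂ e₁ e₂).Adj x y →
      Relation.ReflTransGen G.Adj x y := by
    intro x y hxy
    induction hxy with
    | refl => exact .refl
    | @tail y z _ hyz ih =>
      obtain ⟨e, hl⟩ := hyz
      obtain ⟨-, -, y', z', hl', rfl, rfl⟩ := contractPair_isLink.1 hl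
      exact ((ih.trans (hcol y').2).tail hl'.adj).trans (hcol z').1
  refine ⟨⟨v, h.link₁.left_mem⟩, fun x hx y hy => ?_⟩
  exact ((hcol x).1.trans (hdown _ _ (hG.2 _ (Set.mem_image_of_mem _ hx) _
    (Set.mem_image_of_mem _ hy)))).trans (hcol y).2

theorem isMatchingCovered_contractPair (h : G.IsBicontractible v v₁ v₂ e₁ e₂)
    (hadj : ¬ G.Adj v₁ v₂) (hG : G.IsMatchingCovered)
    (h4 : 4 ≤ V(G.contractPair v v₁ v₂ e₁ e₂).ncard) :
    (G.contractPair v v₁ v₂ e₁ e₂).IsMatchingCovered where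
  connected := h.isConnected_contractPair hG.connected
  four_le := h4
  exists_perfectMatching := by
    intro e he
    rw [edgeSet_contractPair] at he
    obtain ⟨M, hM, heM⟩ := hG.exists_perfectMatching e he.1
    exact ⟨_, h.isPerfectMatching_contractPair hadj hM, heM, he.2⟩

/-- The further edges at `v₁` and `v₂` are needed for `e₁` and `e₂` themselves: a matching lifted
through a further edge at `v₁` uses `e₂`, and vice versa. -/
theorem isMatchingCovered_of_contractPair (h : G.IsBicontractible v v₁ v₂ e₁ e₂)
    (hV : V(G).Finite) (h₁ : ∃ f, G.Inc f v₁ ∧ f ≠ e₁) (h₂ : ∃ f, G.Inc f v₂ ∧ f ≠ e₂)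
    (hG : (G.contractPair v v₁ v₂ e₁ e₂).IsMatchingCovered) : G.IsMatchingCovered where
  connected := h.isConnected_of_contractPair hG.connected
  four_le := by
    have := h.ncard_vertexSet hV
    have := hG.four_le
    omega
  exists_perfectMatching := by
    have key : ∀ {v₁ v₂ e₁ e₂}, G.IsBicontractible v v₁ v₂ e₁ e₂ →
        (∃ f, G.Inc f v₁ ∧ f ≠ e₁) → (G.contractPair v v₁ v₂ e₁ e₂).IsMatchingCovered →
        ∃ M, G.IsPerfectMatching M ∧ e₂ ∈ M := by
      intro v₁ v₂ e₁ e₂ h ⟨f, hf, hfe⟩ hG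
      have hfe₂ : f ≠ e₂ := by
        rintro rfl
        exact (h.inc₂ hf).elim h.ne₁.symm h.ne
      obtain ⟨M, hM, hfM⟩ := hG.exists_perfectMatching f (by
        rw [edgeSet_contractPair]
        exact ⟨hf.edge_mem, by simp [hfe, hfe₂]⟩)
      exact ⟨_, h.isPerfectMatching_insert hM hfM hf, Set.mem_insert _ _⟩
    intro e he
    by_cases he₁ : e = e₁
    · rw [he₁]
      exact key h.symm h₂ (contractPair_comm ▸ hG)
    by_cases he₂ : e = e₂
    · rw [he₂]
      exact key h h₁ hG
    obtain ⟨M, hM, heM⟩ := hG.exists_perfectMatching e (by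
      rw [edgeSet_contractPair]
      exact ⟨he, by simp [he₁, he₂]⟩)
    obtain ⟨f, ⟨hfM, hf⟩, -⟩ := hM.existsUnique v (by
      rw [h.vertexSet_contractPair]
      exact ⟨h.link₁.left_mem, by simp [h.ne₁, h.ne₂]⟩)
    obtain ⟨-, -, hf | hf⟩ := h.contractPair_inc_self.1 hf
    · exact ⟨_, h.isPerfectMatching_insert hM hfM hf, Or.inr heM⟩
    · rw [contractPair_comm] at hM
      exact ⟨_, h.symm.isPerfectMatching_insert hM hfM hf, Or.inr heM⟩

theorem isBipartite_contractPair (h : G.IsBicontractible v v₁ v₂ e₁ e₂) (hG : G.IsBipartite) :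
    (G.contractPair v v₁ v₂ e₁ e₂).IsBipartite := by
  obtain ⟨S, hS⟩ := hG
  have h1 := hS _ _ _ h.link₁
  have h2 := hS _ _ _ h.link₂
  -- The merged vertex takes the common colour of `v₁` and `v₂`, opposite to that of `v`.
  refine ⟨{x | (x = v ∧ v₁ ∈ S) ∨ (x ≠ v ∧ x ∈ S)}, fun e x y hl => ?_⟩
  obtain ⟨he₁, he₂, x', y', hl', rfl, rfl⟩ := contractPair_isLink.1 hl
  have key : ∀ z, G.Inc e z →
      (collapse v v₁ v₂ z ∈ {x | (x = v ∧ v₁ ∈ S) ∨ (x ≠ v ∧ x ∈ S)} ↔ z ∈ S) := by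
    intro z hz
    have hzv : z ≠ v := by
      rintro rfl
      exact (h.inc e hz).elim he₁ he₂
    simp only [Set.mem_ofPred_eq]
    by_cases hc : collapse v v₁ v₂ z = v
    · rcases (collapse_eq_self_iff.1 hc).resolve_left hzv with rfl | rfl
      · simp [hc]
      · simp only [hc, true_and, ne_eq, not_true_eq_false, false_and, or_false]
        tauto
    · rw [← ((collapse_eq_iff_of_ne hc).1 rfl).1]
      simp [hzv]
  rw [key x' hl'.inc_left, key y' hl'.inc_right]
  exact hS e x' y' hl'

theorem isBipartite_of_contractPair (h : G.IsBicontractible v v₁ v₂ e₁ e₂)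
    (hG : (G.contractPair v v₁ v₂ e₁ e₂).IsBipartite) : G.IsBipartite := by
  obtain ⟨S, hS⟩ := hG
  refine ⟨{x | (x = v ∧ v ∉ S) ∨ (x ≠ v ∧ collapse v v₁ v₂ x ∈ S)}, fun e x y hl => ?_⟩
  simp only [Set.mem_ofPred_eq]
  have key : ∀ z, G.IsLink e v z → z ≠ v ∧ collapse v v₁ v₂ z = v := by
    intro z hz
    rcases h.inc e hz.inc_left with rfl | rfl
    · obtain rfl := hz.right_unique h.link₁
      exact ⟨h.ne₁.symm, collapse_left⟩
    · obtain rfl := hz.right_unique h.link₂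
      exact ⟨h.ne₂.symm, collapse_right⟩
  by_cases hx : x = v
  · subst hx
    obtain ⟨h1, h2⟩ := key y hl
    simp [h1, h2]
  by_cases hy : y = v
  · subst hy
    obtain ⟨h1, h2⟩ := key x hl.symm
    simp [h1, h2]
  have he₁ : e ≠ e₁ := by
    rintro rfl
    rcases h.link₁.left_eq_or_eq hl with hv | hv
    · exact hx hv.symm
    · exact hy hv.symm
  have he₂ : e ≠ e₂ := by
    rintro rfl
    rcases h.link₂.left_eq_or_eq hl with hv | hv
    · exact hx hv.symm
    · exact hy hv.symm
  have := hS e _ _ (contractPair_isLink.2 ⟨he₁, he₂, _, _, hl, rfl, rfl⟩)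
  simpa [hx, hy] using this

end IsBicontractible

end Graph

/-! ### Degrees, minimality and counts under contraction -/

namespace Graph

variable {α β : Type*} {G : Graph α β} {v v₁ v₂ : α} {e₁ e₂ : β}

theorem IsBipartite.degree_eq (h : G.IsBipartite) (x : α) :
    G.degree x = {e | G.Inc e x}.ncard := by
  obtain ⟨X, Y, h⟩ := h.exists_isBipartition
  exact h.degree_eq x

theorem finite_inc (hE : E(G).Finite) (x : α) : {e | G.Inc e x}.Finite :=
  hE.subset fun _ he => he.edge_mem

theorem IsBipartite.deleteEdges (h : G.IsBipartite) (F : Set β) :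
    (G.deleteEdges F).IsBipartite := by
  obtain ⟨S, hS⟩ := h
  exact ⟨S, fun e x y hl => hS e x y (by rw [deleteEdges_isLink] at hl; exact hl.1)⟩

theorem IsBipartite.exists_inc_of_three_le_degree (hG : G.IsBipartite) {x : α} (hx : 3 ≤ G.degree x)
    (e e' : β) : ∃ f, G.Inc f x ∧ f ≠ e ∧ f ≠ e' := by
  rw [hG.degree_eq] at hx
  obtain ⟨f, hf, hne⟩ := Set.exists_mem_notMem_of_ncard_lt_ncard
    (s := {e, e'}) (t := {f | G.Inc f x}) 
      (((Set.ncard_insert_le e {e'}).trans_eq (by rw [Set.ncard_singleton])).trans_lt hx)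
  exact ⟨f, hf, by simpa using hne⟩

theorem IsMatchingCovered.exists_inc_ne (hG : G.IsMatchingCovered) (hb : G.IsBipartite)
    (hV : V(G).Finite) {x : α} (hx : x ∈ V(G)) (e : β) : ∃ f, G.Inc f x ∧ f ≠ e := by
  have key : ∀ X Y : Set α, G.IsBipartition X Y → x ∈ Y → ∃ f, G.Inc f x ∧ f ≠ e := by
    intro X Y h hxY
    have := (hV.subset (h.union ▸ Set.subset_union_left : X ⊆ V(G))).fintype
    have := (hV.subset (h.union ▸ Set.subset_union_right : Y ⊆ V(G))).fintype
    have hR := hG.strictHall h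
    obtain ⟨f, y, hl⟩ := hG.exists_edge x hx
    by_cases hf : f = e
    · subst hf
      obtain ⟨a, hne, f', hl'⟩ := hR.exists_ne (hG.two_le_card h)
        ⟨y, (h.link _ _ _ hl.symm).2 hxY⟩ ⟨x, hxY⟩
      refine ⟨f', hl'.inc_right, ?_⟩
      rintro rfl
      exact hne (Subtype.ext (hl'.symm.right_unique hl))
    · exact ⟨f, ⟨y, hl⟩, hf⟩
  obtain ⟨X, Y, h⟩ := hb.exists_isBipartition
  rcases h.mem_or_mem hx with hx | hx
  · exact key Y X h.symm hx
  · exact key X Y h hx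

theorem IsMatchingCovered.two_le_degree (hG : G.IsMatchingCovered) (hb : G.IsBipartite)
    (hV : V(G).Finite) (hE : E(G).Finite) {x : α} (hx : x ∈ V(G)) : 2 ≤ G.degree x := by
  obtain ⟨f, hf⟩ := hG.exists_edge x hx
  obtain ⟨f', hf', hne⟩ := hG.exists_inc_ne hb hV hx f
  rw [hb.degree_eq, ← Set.ncard_pair hne]
  refine Set.ncard_le_ncard ?_ (finite_inc hE x)
  rintro g (rfl | rfl)
  · exact hf'
  · exact hf

namespace IsMinimalBipartiteMatchingCovered

/-- Without parallel edges, a degree is at most the size of the opposite colour class, which is n/2.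
-/
theorem two_mul_degree_le (hG : G.IsMinimalBipartiteMatchingCovered) (hV : V(G).Finite)
    {x : α} (hx : x ∈ V(G)) : 2 * G.degree x ≤ V(G).ncard := by
  have key : ∀ X Y : Set α, G.IsBipartition X Y → x ∈ X → 2 * G.degree x ≤ V(G).ncard := by
    intro X Y h hxX
    have := (hV.subset (h.union ▸ Set.subset_union_left : X ⊆ V(G))).fintype
    have := (hV.subset (h.union ▸ Set.subset_union_right : Y ⊆ V(G))).fintype
    have h1 := hG.degree_eq_card h ⟨x, hxX⟩
    have h2 := hG.matchingCovered.card_eq h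
    rw [h.ncard_eq, show G.degree x = _ from h1, h2, ← two_mul]
    exact Nat.mul_le_mul_left _ (Finset.card_le_univ _)
  obtain ⟨X, Y, h⟩ := hG.bipartite.exists_isBipartition
  rcases h.mem_or_mem hx with hx | hx
  · exact key X Y h hx
  · exact key Y X h.symm hx

theorem eq_of_isLink (hG : G.IsMinimalBipartiteMatchingCovered) (hV : V(G).Finite)
    {e e' : β} {x y : α} (hl : G.IsLink e x y) (hl' : G.IsLink e' x y) : e' = e := by
  obtain ⟨X, Y, h⟩ := hG.bipartite.exists_isBipartition
  have := (hV.subset (h.union ▸ Set.subset_union_left : X ⊆ V(G))).fintype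
  have := (hV.subset (h.union ▸ Set.subset_union_right : Y ⊆ V(G))).fintype
  rcases h.mem_or_mem hl.left_mem with hx | hx
  · exact (hG.exists_isBarrier h (x := ⟨x, hx⟩) (y := ⟨y, (h.link _ _ _ hl).1 hx⟩) hl).2 e' hl'
  · exact (hG.exists_isBarrier h (x := ⟨y, (h.link _ _ _ hl.symm).2 hx⟩) (y := ⟨x, hx⟩)
      hl.symm).2 e' hl'.symm

theorem even_ncard (hG : G.IsMinimalBipartiteMatchingCovered) (hV : V(G).Finite) :
    Even V(G).ncard := by
  obtain ⟨X, Y, h⟩ := hG.bipartite.exists_isBipartition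
  have := (hV.subset (h.union ▸ Set.subset_union_left : X ⊆ V(G))).fintype
  have := (hV.subset (h.union ▸ Set.subset_union_right : Y ⊆ V(G))).fintype
  exact ⟨Fintype.card Y, by rw [h.ncard_eq, hG.matchingCovered.card_eq h]⟩

end IsMinimalBipartiteMatchingCovered

namespace IsBicontractible

theorem not_adj (h : G.IsBicontractible v v₁ v₂ e₁ e₂) (hG : G.IsBipartite) : ¬ G.Adj v₁ v₂ := by
  obtain ⟨S, hS⟩ := hG
  rintro ⟨e, hl⟩
  have h1 := hS _ _ _ h.link₁
  have h2 := hS _ _ _ h.link₂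
  have h3 := hS _ _ _ hl
  tauto

theorem degree_contractPair_of_ne (h : G.IsBicontractible v v₁ v₂ e₁ e₂) (hG : G.IsBipartite)
    {x : α} (hv : x ≠ v) (h₁ : x ≠ v₁) (h₂ : x ≠ v₂) :
    (G.contractPair v v₁ v₂ e₁ e₂).degree x = G.degree x := by
  rw [hG.degree_eq, (h.isBipartite_contractPair hG).degree_eq]
  simp only [h.contractPair_inc_of_ne hv h₁ h₂]

theorem degree_contractPair_self (h : G.IsBicontractible v v₁ v₂ e₁ e₂) (hG : G.IsBipartite)
    (hE : E(G).Finite) :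
    (G.contractPair v v₁ v₂ e₁ e₂).degree v + 2 = G.degree v₁ + G.degree v₂ := by
  have hset : {e | (G.contractPair v v₁ v₂ e₁ e₂).Inc e v} =
      ({e | G.Inc e v₁} \ {e₁}) ∪ ({e | G.Inc e v₂} \ {e₂}) := by
    ext e
    simp only [h.contractPair_inc_self, Set.mem_union, Set.mem_sdiff, Set.mem_ofPred_eq,
      Set.mem_singleton_iff]
    constructor
    · tauto
    · rintro (⟨hi, he⟩ | ⟨hi, he⟩)
      · refine ⟨he, ?_, Or.inl hi⟩
        rintro rfl
        exact (h.inc₂ hi).elim h.ne₁.symm h.ne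
      · refine ⟨?_, he, Or.inr hi⟩
        rintro rfl
        exact (h.inc₁ hi).elim h.ne₂.symm h.ne.symm
  have hdis : Disjoint ({e | G.Inc e v₁} \ {e₁}) ({e | G.Inc e v₂} \ {e₂}) := by
    rw [Set.disjoint_left]
    rintro e ⟨⟨w, hl⟩, -⟩ ⟨hi, -⟩
    obtain rfl := Inc.eq_of_isLink_of_ne_left hi hl h.ne.symm
    exact h.not_adj hG ⟨e, hl⟩
  have h1 := Set.ncard_sdiff_singleton_add_one (s := {e | G.Inc e v₁}) h.link₁.inc_right
    (finite_inc hE v₁)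
  have h2 := Set.ncard_sdiff_singleton_add_one (s := {e | G.Inc e v₂}) h.link₂.inc_right
    (finite_inc hE v₂)
  rw [hG.degree_eq, hG.degree_eq, (h.isBipartite_contractPair hG).degree_eq, hset,
    Set.ncard_union_eq hdis ((finite_inc hE v₁).sdiff) ((finite_inc hE v₂).sdiff)]
  omega

/-- A deletable edge of the contraction would be deletable in `G`; `hdel` supplies the edges at `v₁`
and `v₂` that lifting matchings requires. -/
theorem isMinimal_contractPair (h : G.IsBicontractible v v₁ v₂ e₁ e₂)
    (hG : G.IsMinimalBipartiteMatchingCovered) (hV : V(G).Finite)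
    (h4 : 4 ≤ V(G.contractPair v v₁ v₂ e₁ e₂).ncard)
    (hdel : ∀ e, ((G.contractPair v v₁ v₂ e₁ e₂).deleteEdges {e}).IsMatchingCovered →
      (∃ f, G.Inc f v₁ ∧ f ≠ e₁ ∧ f ≠ e) ∧ ∃ f, G.Inc f v₂ ∧ f ≠ e₂ ∧ f ≠ e) :
    (G.contractPair v v₁ v₂ e₁ e₂).IsMinimalBipartiteMatchingCovered where
  bipartite := h.isBipartite_contractPair hG.bipartite
  matchingCovered :=
    h.isMatchingCovered_contractPair (h.not_adj hG.bipartite) hG.matchingCovered h4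
  minimal := by
    intro e he hmc
    rw [edgeSet_contractPair] at he
    have he' := he.2
    simp only [Set.mem_insert_iff, Set.mem_singleton_iff, not_or] at he'
    obtain ⟨⟨f₁, hf₁, hfe₁, hfe⟩, f₂, hf₂, hfe₂, hfe'⟩ := hdel e hmc
    refine hG.minimal e he.1 ((h.deleteEdges he'.1 he'.2).isMatchingCovered_of_contractPair hV
      ⟨f₁, by simp [hf₁, hfe], hfe₁⟩ ⟨f₂, by simp [hf₂, hfe'], hfe₂⟩ ?_)
    rwa [contractPair_deleteEdges]

end IsBicontractible

/-- The data of a restricted bicontraction, and of its result. -/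
theorem RestrictedBicontraction.exists_isBicontractible {G' : Graph α β}
    (h : G.RestrictedBicontraction G') (hE : E(G).Finite) :
    ∃ v v₁ v₂ e₁ e₂, G.IsBicontractible v v₁ v₂ e₁ e₂ ∧ 3 ≤ G.degree v₁ ∧ 3 ≤ G.degree v₂ ∧
      G' = G.contractPair v v₁ v₂ e₁ e₂ := by
  obtain ⟨v, v₁, v₂, e₁, e₂, hl₁, hl₂, hne, hd, hd₁, hd₂, rfl⟩ := h
  have hn₁ : v ≠ v₁ := by
    rintro rfl
    omega
  have hn₂ : v ≠ v₂ := by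
    rintro rfl
    omega
  have hee : e₁ ≠ e₂ := by
    rintro rfl
    exact hne (hl₁.right_unique hl₂)
  refine ⟨v, v₁, v₂, e₁, e₂, ⟨hl₁, hl₂, hne, hn₁, hn₂, fun e he => ?_⟩, hd₁, hd₂, rfl⟩
  have hfin : {e | G.IsNonloopAt e v}.Finite := hE.subset fun _ he => he.edge_mem
  have hfin' : {e | G.IsLoopAt e v}.Finite := hE.subset fun _ he => he.edge_mem
  have hsub : {e₁, e₂} ⊆ {e | G.IsNonloopAt e v} := by
    rintro f (rfl | rfl)
    · exact ⟨v₁, hn₁.symm, hl₁⟩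
    · exact ⟨v₂, hn₂.symm, hl₂⟩
  have hle := Set.ncard_le_ncard hsub hfin
  rw [Set.ncard_pair hee] at hle
  rw [degree] at hd
  have h0 : {e | G.IsLoopAt e v}.ncard = 0 := by omega
  rw [Set.ncard_eq_zero hfin'] at h0
  have heq := Set.eq_of_subset_of_ncard_le hsub (by rw [Set.ncard_pair hee]; omega) hfin
  rcases he.isLoopAt_or_isNonloopAt with hl | hl
  · have : e ∈ {e | G.IsLoopAt e v} := hl
    simp [h0] at this
  · have : e ∈ ({e₁, e₂} : Set β) := heq ▸ hl
    simpa using this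

namespace IsBicontractible

theorem isMinimal_iff_of_three_le_degree (h : G.IsBicontractible v v₁ v₂ e₁ e₂)
    (hV : V(G).Finite) (h₁ : 3 ≤ G.degree v₁) (h₂ : 3 ≤ G.degree v₂) :
    (G.contractPair v v₁ v₂ e₁ e₂).IsMinimalBipartiteMatchingCovered ↔
      G.IsMinimalBipartiteMatchingCovered := by
  constructor
  · intro hG
    have hb := h.isBipartite_of_contractPair hG.bipartite
    have hn₁ := hb.exists_inc_of_three_le_degree h₁ e₁ e₁
    have hn₂ := hb.exists_inc_of_three_le_degree h₂ e₂ e₂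
    refine ⟨hb, h.isMatchingCovered_of_contractPair hV (hn₁.imp fun f hf => ⟨hf.1, hf.2.1⟩)
      (hn₂.imp fun f hf => ⟨hf.1, hf.2.1⟩) hG.matchingCovered, fun e he hmc => ?_⟩
    have hvV : v ∈ V(G.deleteEdges {e}) := h.link₁.left_mem
    -- Deleting `e₁` or `e₂` leaves `v` with a single edge, which a bipartite matching covered graph
    -- does not allow.
    by_cases he₁ : e = e₁
    · obtain ⟨f, hf, hne⟩ := hmc.exists_inc_ne (hb.deleteEdges _) hV hvV e₂
      rw [deleteEdges_inc] at hf
      exact (h.inc f hf.1).elim (fun hfe => hf.2 (hfe.trans he₁.symm)) hne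
    by_cases he₂ : e = e₂
    · obtain ⟨f, hf, hne⟩ := hmc.exists_inc_ne (hb.deleteEdges _) hV hvV e₁
      rw [deleteEdges_inc] at hf
      exact (h.inc f hf.1).elim hne (fun hfe => hf.2 (hfe.trans he₂.symm))
    have h' := h.deleteEdges he₁ he₂
    refine hG.minimal e (by rw [edgeSet_contractPair]; exact ⟨he, by simp [he₁, he₂]⟩) ?_
    rw [← contractPair_deleteEdges]
    refine h'.isMatchingCovered_contractPair (h'.not_adj (hb.deleteEdges _)) hmc ?_
    rw [contractPair_deleteEdges]
    exact hG.matchingCovered.four_le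
  · intro hG
    refine h.isMinimal_contractPair hG hV ?_ fun e _ =>
      ⟨hG.bipartite.exists_inc_of_three_le_degree h₁ _ _,
        hG.bipartite.exists_inc_of_three_le_degree h₂ _ _⟩
    have := hG.two_mul_degree_le hV h.link₁.right_mem
    have := h.ncard_vertexSet hV
    omega

/-- Edges at `v₁` or `v₂` have an end of degree at least 3 before the contraction and one of degree
at least 4 after it, so they never count. All other degrees are unchanged. -/
theorem twoEdges_contractPair (h : G.IsBicontractible v v₁ v₂ e₁ e₂) (hG : G.IsBipartite)
    (hE : E(G).Finite) (h₁ : 3 ≤ G.degree v₁) (h₂ : 3 ≤ G.degree v₂) :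
    (G.contractPair v v₁ v₂ e₁ e₂).twoEdges = G.twoEdges := by
  have hself := h.degree_contractPair_self hG hE
  ext e
  simp only [twoEdges, edgeSet_contractPair, Set.mem_ofPred_eq, Set.mem_sdiff,
    Set.mem_insert_iff, Set.mem_singleton_iff, not_or]
  constructor
  · rintro ⟨⟨he, he₁, he₂⟩, hdeg⟩
    refine ⟨he, fun x hx => ?_⟩
    have hi := contractPair_inc (v := v) (v₁ := v₁) (v₂ := v₂) |>.2 ⟨he₁, he₂, x, hx, rfl⟩
    have hd := hdeg _ hi
    have hne : collapse v v₁ v₂ x ≠ v := by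
      intro hc
      rw [hc] at hd
      omega
    obtain ⟨h1, h2, h3⟩ := (collapse_eq_iff_of_ne hne).1 rfl
    rw [← h1] at hne h2 h3 hd
    rwa [h.degree_contractPair_of_ne hG hne h2 h3] at hd
  · rintro ⟨he, hdeg⟩
    have hn₁ : ¬ G.Inc e v₁ := fun hi => by
      have := hdeg _ hi
      omega
    have hn₂ : ¬ G.Inc e v₂ := fun hi => by
      have := hdeg _ hi
      omega
    refine ⟨⟨he, ?_, ?_⟩, fun x hx => ?_⟩
    · rintro rfl
      exact hn₁ h.link₁.inc_right
    · rintro rfl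
      exact hn₂ h.link₂.inc_right
    · by_cases hxv : x = v
      · subst hxv
        exact absurd (h.contractPair_inc_self.1 hx).2.2 (by tauto)
      · obtain ⟨-, -, y, hy, hyx⟩ := contractPair_inc.1 hx
        obtain ⟨rfl, h2, h3⟩ := (collapse_eq_iff_of_ne hxv).1 hyx
        rw [h.degree_contractPair_of_ne hG hxv h2 h3]
        exact hdeg _ hy

/-- If the contraction minus `e` is matching covered, its merged vertex has two edges. Each of `v₁`,
`v₂` supplies at most one, so each keeps one and matchings lift. -/
theorem isMinimal_contractPair_of_degree_eq_two (h : G.IsBicontractible v v₁ v₂ e₁ e₂)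
    (hG : G.IsMinimalBipartiteMatchingCovered) (hV : V(G).Finite) (hE : E(G).Finite)
    (h₁ : G.degree v₁ = 2) (h₂ : G.degree v₂ = 2) (h6 : 6 ≤ V(G).ncard) :
    (G.contractPair v v₁ v₂ e₁ e₂).IsMinimalBipartiteMatchingCovered := by
  have hV' : V(G.contractPair v v₁ v₂ e₁ e₂).Finite := by
    rw [h.vertexSet_contractPair]
    exact hV.sdiff
  have key : ∀ {v₁ v₂ e₁ e₂}, G.IsBicontractible v v₁ v₂ e₁ e₂ → G.degree v₂ = 2 →
      V(G.contractPair v v₁ v₂ e₁ e₂).Finite → ∀ e,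
      ((G.contractPair v v₁ v₂ e₁ e₂).deleteEdges {e}).IsMatchingCovered →
      ∃ f, G.Inc f v₁ ∧ f ≠ e₁ ∧ f ≠ e := by
    intro v₁ v₂ e₁ e₂ h h₂ hV' e hmc
    have hb := (h.isBipartite_contractPair hG.bipartite).deleteEdges {e}
    have hv : v ∈ V((G.contractPair v v₁ v₂ e₁ e₂).deleteEdges {e}) := by
      show v ∈ V(G.contractPair v v₁ v₂ e₁ e₂)
      rw [h.vertexSet_contractPair]
      exact ⟨h.link₁.left_mem, by simp [h.ne₁, h.ne₂]⟩
    obtain ⟨f, hf⟩ := hmc.exists_edge v hv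
    obtain ⟨f', hf', hne⟩ := hmc.exists_inc_ne hb hV' hv f
    rw [deleteEdges_inc, h.contractPair_inc_self, Set.mem_singleton_iff] at hf hf'
    obtain ⟨⟨ha, hb', hi⟩, hc⟩ := hf
    obtain ⟨⟨ha', hb'', hi'⟩, hc'⟩ := hf'
    rcases hi with hi | hi
    · exact ⟨f, hi, ha, hc⟩
    rcases hi' with hi' | hi'
    · exact ⟨f', hi', ha', hc'⟩
    exfalso
    rw [hG.bipartite.degree_eq] at h₂
    have hsub : ({e₂, f', f} : Set β) ⊆ {e | G.Inc e v₂} := by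
      rintro g (rfl | rfl | rfl)
      · exact h.link₂.inc_right
      · exact hi'
      · exact hi
    have hle := Set.ncard_le_ncard hsub (finite_inc hE v₂)
    rw [Set.ncard_insert_of_notMem (by
      simp only [Set.mem_insert_iff, Set.mem_singleton_iff, not_or]
      exact ⟨hb''.symm, hb'.symm⟩), Set.ncard_pair hne] at hle
    omega
  refine h.isMinimal_contractPair hG hV ?_ fun e hmc => ⟨key h h₂ hV' e hmc, ?_⟩
  · have := h.ncard_vertexSet hV
    omega
  · rw [contractPair_comm] at hmc hV'
    exact key h.symm h₁ hV' e hmc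

theorem ncard_twoVertices_contractPair_of_degree_eq_two (h : G.IsBicontractible v v₁ v₂ e₁ e₂)
    (hG : G.IsBipartite) (hV : V(G).Finite) (hE : E(G).Finite) (hv : G.degree v = 2)
    (h₁ : G.degree v₁ = 2) (h₂ : G.degree v₂ = 2) :
    (G.contractPair v v₁ v₂ e₁ e₂).twoVertices.ncard + 2 = G.twoVertices.ncard := by
  have hset : (G.contractPair v v₁ v₂ e₁ e₂).twoVertices = G.twoVertices \ {v₁, v₂} := by
    ext x
    simp only [twoVertices, h.vertexSet_contractPair, Set.mem_ofPred_eq, Set.mem_sdiff,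
      Set.mem_insert_iff, Set.mem_singleton_iff, not_or]
    by_cases hxv : x = v
    · subst hxv
      have := h.degree_contractPair_self hG hE
      have hd : (G.contractPair x v₁ v₂ e₁ e₂).degree x = 2 := by omega
      simp [hd, hv]
    by_cases hx₁ : x = v₁
    · simp [hx₁]
    by_cases hx₂ : x = v₂
    · simp [hx₂]
    rw [h.degree_contractPair_of_ne hG hxv hx₁ hx₂]
    tauto
  rw [hset, ← Set.ncard_pair h.ne]
  refine Set.ncard_sdiff_add_ncard_of_subset ?_ (hV.subset fun x hx => hx.1)
  rintro x (rfl | rfl)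
  · exact ⟨h.link₁.right_mem, h₁⟩
  · exact ⟨h.link₂.right_mem, h₂⟩

end IsBicontractible

end Graph

/-! ### The case of four vertices, and graphs without restricted bicontractions -/

namespace Graph

variable {α β : Type*} {G : Graph α β}

theorem isIsomorphic_ofSimpleGraph {W : Type*} {S : SimpleGraph W} (φ : V(G) ≃ W)
    (hadj : ∀ x y : V(G), G.Adj x y ↔ S.Adj (φ x) (φ y))
    (hG : ∀ e e' x y, G.IsLink e x y → G.IsLink e' x y → e' = e) :
    G.IsIsomorphic (ofSimpleGraph S) := by
  let ψ : V(G) ≃ V(ofSimpleGraph S) := φ.trans (Equiv.Set.univ W).symm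
  have hψ : ∀ x, (ψ x : W) = φ x := fun x => rfl
  have hlink : ∀ (s : Sym2 W) (i j : W), (ofSimpleGraph S).IsLink s i j ↔ s = s(i, j) ∧ S.Adj i j := by
    intro s i j
    simp only [ofSimpleGraph_isLink]
    constructor
    · rintro ⟨rfl, hs⟩
      exact ⟨rfl, hs⟩
    · rintro ⟨rfl, hs⟩
      exact ⟨rfl, hs⟩
  have hex : ∀ e : E(G), ∃ s : E(ofSimpleGraph S), ∀ x y : V(G),
      G.IsLink e x y ↔ (ofSimpleGraph S).IsLink s (ψ x) (ψ y) := by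
    rintro ⟨e, he⟩
    obtain ⟨x, y, hl⟩ := exists_isLink_of_mem_edgeSet he
    have hS := (hadj ⟨x, hl.left_mem⟩ ⟨y, hl.right_mem⟩).1 ⟨e, hl⟩
    have hs := (hlink _ _ _).2 ⟨rfl, hS⟩
    refine ⟨⟨_, hs.edge_mem⟩, fun x' y' => ?_⟩
    rw [hl.isLink_iff_sym2_eq, hs.isLink_iff_sym2_eq, Sym2.eq_iff, Sym2.eq_iff]
    simp only [hψ, φ.injective.eq_iff, Subtype.ext_iff]
  choose F hF using hex
  refine ⟨ψ, Equiv.ofBijective F ⟨fun e e' heq => ?_, fun s => ?_⟩, fun e x y => hF e x y⟩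
  · obtain ⟨x, y, hl⟩ := exists_isLink_of_mem_edgeSet e.2
    have h1 := (hF e ⟨x, hl.left_mem⟩ ⟨y, hl.right_mem⟩).1 hl
    rw [heq] at h1
    exact (Subtype.ext (hG _ _ _ _ hl ((hF e' _ _).2 h1))).symm
  · obtain ⟨i, j, hs⟩ := exists_isLink_of_mem_edgeSet s.2
    obtain ⟨x, rfl⟩ := φ.surjective i
    obtain ⟨y, rfl⟩ := φ.surjective j
    obtain ⟨hsij, hS⟩ := (hlink _ _ _).1 hs
    obtain ⟨e, hl⟩ := (hadj x y).2 hS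
    refine ⟨⟨e, hl.edge_mem⟩, Subtype.ext ?_⟩
    have := (hF ⟨e, hl.edge_mem⟩ x y).1 hl
    rw [hsij]
    exact ((hlink _ _ _).1 this).1

open Classical in
theorem IsMinimalBipartiteMatchingCovered.isIsomorphic_cycleFour
    (hG : G.IsMinimalBipartiteMatchingCovered) (hV : V(G).Finite) (h4 : V(G).ncard = 4) :
    G.IsIsomorphic cycleFour := by
  obtain ⟨X, Y, h⟩ := hG.bipartite.exists_isBipartition
  have := (hV.subset (h.union ▸ Set.subset_union_left : X ⊆ V(G))).fintype
  have := (hV.subset (h.union ▸ Set.subset_union_right : Y ⊆ V(G))).fintype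
  have hc := hG.matchingCovered.card_eq h
  have hn := h.ncard_eq
  have hR := hG.matchingCovered.strictHall h
  have hadj : ∀ x ∈ X, ∀ y ∈ Y, G.Adj x y := by
    intro x hx y hy
    by_contra hxy
    have h2 := hR.two_le_card_left hc (hG.matchingCovered.two_le_card h) ⟨x, hx⟩
    have h3 : (Finset.univ.filter (G.adjBetween X Y ⟨x, hx⟩)).card < Fintype.card Y := by
      rw [← Finset.card_univ]
      refine Finset.card_lt_card ((Finset.ssubset_iff_of_subset (Finset.subset_univ _)).2
        ⟨⟨y, hy⟩, Finset.mem_univ _, ?_⟩)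
      simpa [adjBetween] using hxy
    omega
  have hXc : X.ncard = 2 := by
    rw [← Nat.card_coe_set_eq, Nat.card_eq_fintype_card]
    omega
  have hYc : Y.ncard = 2 := by
    rw [← Nat.card_coe_set_eq, Nat.card_eq_fintype_card]
    omega
  obtain ⟨x₀, x₁, hx, rfl⟩ := Set.ncard_eq_two.1 hXc
  obtain ⟨y₀, y₁, hy, rfl⟩ := Set.ncard_eq_two.1 hYc
  have hnX : ∀ x ∈ ({x₀, x₁} : Set α), ∀ x' ∈ ({x₀, x₁} : Set α), ¬ G.Adj x x' := by
    rintro x hx x' hx' ⟨e, hl⟩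
    exact h.notMem_right hx' ((h.link _ _ _ hl).1 hx)
  have hnY : ∀ y ∈ ({y₀, y₁} : Set α), ∀ y' ∈ ({y₀, y₁} : Set α), ¬ G.Adj y y' := by
    rintro y hy y' hy' ⟨e, hl⟩
    exact h.symm.notMem_right hy' ((h.symm.link _ _ _ hl).1 hy)
  have hmem : ∀ z, z ∈ V(G) ↔ z = x₀ ∨ z = x₁ ∨ z = y₀ ∨ z = y₁ := by
    intro z
    rw [← h.union]
    simp only [Set.mem_union, Set.mem_insert_iff, Set.mem_singleton_iff, or_assoc]
  have hdis : ∀ x ∈ ({x₀, x₁} : Set α), ∀ y ∈ ({y₀, y₁} : Set α), x ≠ y := by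
    rintro x hx y hy rfl
    exact h.notMem_right hx hy
  simp only [Set.mem_insert_iff, Set.mem_singleton_iff, forall_eq_or_imp, forall_eq]
    at hadj hnX hnY hdis
  -- The colour classes alternate around the cycle.
  let g : Fin 4 → V(G) := ![⟨x₀, by simp [hmem]⟩, ⟨y₀, by simp [hmem]⟩, ⟨x₁, by simp [hmem]⟩,
    ⟨y₁, by simp [hmem]⟩]
  have hg : Function.Bijective g := by
    constructor
    · intro i j hij
      fin_cases i <;> fin_cases j <;> simp [g] at hij ⊢ <;> grind
    · rintro ⟨z, hz⟩
      rcases (hmem z).1 hz with rfl | rfl | rfl | rfl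
      · exact ⟨0, rfl⟩
      · exact ⟨2, rfl⟩
      · exact ⟨1, rfl⟩
      · exact ⟨3, rfl⟩
  refine isIsomorphic_ofSimpleGraph (Equiv.ofBijective g hg).symm ?_
    fun e e' x y hl hl' => hG.eq_of_isLink hV hl hl'
  have key : ∀ i j, G.Adj (g i) (g j) ↔ (SimpleGraph.cycleGraph 4).Adj i j := by
    have hadj' := hadj
    simp only [adj_comm x₀, adj_comm x₁] at hadj'
    intro i j
    rw [SimpleGraph.cycleGraph_adj]
    fin_cases i <;> fin_cases j <;> simp [g, hadj, hadj', hnX, hnY] <;> decide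
  intro x y
  obtain ⟨i, rfl⟩ := hg.2 x
  obtain ⟨j, rfl⟩ := hg.2 y
  rw [Equiv.ofBijective_symm_apply_apply, Equiv.ofBijective_symm_apply_apply]
  exact key i j

/-- Otherwise both neighbours, distinct for want of parallel edges, would have degree at least 3 and
`x` could be bicontracted. -/
theorem IsMinimalBipartiteMatchingCovered.exists_mem_twoEdges
    (hG : G.IsMinimalBipartiteMatchingCovered) (hV : V(G).Finite) (hE : E(G).Finite)
    (hH : ∀ G', ¬ G.RestrictedBicontraction G') {x : α} (hx : x ∈ G.twoVertices) :
    ∃ e ∈ G.twoEdges, G.Inc e x := by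
  obtain ⟨e₁, v₁, hl₁⟩ := hG.matchingCovered.exists_edge x hx.1
  obtain ⟨e₂, ⟨v₂, hl₂⟩, hne⟩ := hG.matchingCovered.exists_inc_ne hG.bipartite hV hx.1 e₁
  have hv : v₁ ≠ v₂ := by
    rintro rfl
    exact hne (hG.eq_of_isLink hV hl₁ hl₂)
  have key : ∀ e w, G.IsLink e x w → G.degree w = 2 → e ∈ G.twoEdges := by
    intro e w hl hw
    refine ⟨hl.edge_mem, fun z hz => ?_⟩
    rcases hz.eq_or_eq_of_isLink hl with rfl | rfl
    · exact hx.2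
    · exact hw
  have h₁ := hG.matchingCovered.two_le_degree hG.bipartite hV hE hl₁.right_mem
  have h₂ := hG.matchingCovered.two_le_degree hG.bipartite hV hE hl₂.right_mem
  by_cases hd₁ : G.degree v₁ = 2
  · exact ⟨e₁, key _ _ hl₁ hd₁, hl₁.inc_left⟩
  by_cases hd₂ : G.degree v₂ = 2
  · exact ⟨e₂, key _ _ hl₂ hd₂, hl₂.inc_left⟩
  exact absurd ⟨x, v₁, v₂, e₁, e₂, hl₁, hl₂, hv, hx.2, by omega, by omega, rfl⟩ (hH _)

theorem IsMinimalBipartiteMatchingCovered.isBicontractible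
    (hG : G.IsMinimalBipartiteMatchingCovered) (hV : V(G).Finite) (hE : E(G).Finite)
    {v v₁ v₂ : α} {e₁ e₂ : β} (hl₁ : G.IsLink e₁ v v₁) (hl₂ : G.IsLink e₂ v v₂) (hne : e₁ ≠ e₂)
    (hv : G.degree v = 2) : G.IsBicontractible v v₁ v₂ e₁ e₂ := by
  obtain ⟨X, Y, h⟩ := hG.bipartite.exists_isBipartition
  refine ⟨hl₁, hl₂, ?_, ?_, ?_, fun e he => ?_⟩
  · rintro rfl
    exact hne.symm (hG.eq_of_isLink hV hl₁ hl₂)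
  · rintro rfl
    exact h.not_isLoopAt _ _ hl₁
  · rintro rfl
    exact h.not_isLoopAt _ _ hl₂
  · rw [hG.bipartite.degree_eq] at hv
    have hsub : {e₁, e₂} ⊆ {e | G.Inc e v} := by
      rintro f (rfl | rfl)
      · exact hl₁.inc_left
      · exact hl₂.inc_left
    have heq := Set.eq_of_subset_of_ncard_le hsub (by rw [Set.ncard_pair hne, hv])
      (finite_inc hE v)
    have : e ∈ ({e₁, e₂} : Set β) := heq ▸ he
    simpa using this

open Finset Classical in
/-- Each member of `twoEdges` is incident with two members of `twoVertices`. -/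
theorem IsBipartite.two_mul_ncard_twoEdges (hG : G.IsBipartite) (hV : V(G).Finite)
    (hE : E(G).Finite) :
    ∑ x ∈ (hV.subset (fun _ hx => hx.1 : G.twoVertices ⊆ V(G))).toFinset,
      {e ∈ G.twoEdges | G.Inc e x}.ncard = 2 * G.twoEdges.ncard := by
  have hVf := hV.subset (fun _ hx => hx.1 : G.twoVertices ⊆ V(G))
  have hEf := hE.subset (fun _ hx => hx.1 : G.twoEdges ⊆ E(G))
  have hcount := sum_card_bipartiteAbove_eq_sum_card_bipartiteBelow (fun (x : α) (e : β) => G.Inc e x)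
    (s := hVf.toFinset) (t := hEf.toFinset)
  have h1 : ∀ x ∈ hVf.toFinset, {e ∈ G.twoEdges | G.Inc e x}.ncard =
      (bipartiteAbove (fun (x : α) (e : β) => G.Inc e x) hEf.toFinset x).card := by
    intro x _
    rw [← Set.ncard_coe_finset]
    congr 1
    ext e
    simp [bipartiteAbove]
  have h2 : ∀ e ∈ hEf.toFinset,
      (bipartiteBelow (fun (x : α) (e : β) => G.Inc e x) hVf.toFinset e).card = 2 := by
    intro e he
    rw [Set.Finite.mem_toFinset] at he
    obtain ⟨x, y, hl⟩ := exists_isLink_of_mem_edgeSet he.1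
    have hxy : x ≠ y := by
      rintro rfl
      obtain ⟨X, Y, h⟩ := hG.exists_isBipartition
      exact h.not_isLoopAt _ _ hl
    rw [← card_pair hxy]
    congr 1
    ext z
    simp only [bipartiteBelow, mem_filter, Set.Finite.mem_toFinset, mem_insert, mem_singleton]
    constructor
    · exact fun hz => hz.2.eq_or_eq_of_isLink hl
    · rintro (rfl | rfl)
      · exact ⟨⟨hl.left_mem, he.2 _ hl.inc_left⟩, hl.inc_left⟩
      · exact ⟨⟨hl.right_mem, he.2 _ hl.inc_right⟩, hl.inc_right⟩
  rw [sum_congr rfl h1, hcount, sum_congr rfl h2, sum_const, smul_eq_mul, mul_comm,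
    Set.ncard_eq_toFinset_card _ hEf]

/-- For a graph without restricted bicontractions the two notions of extremality agree. -/
theorem isTwoEdgeExtremal_iff_isTwoVertexExtremal (hV : V(G).Finite) (hE : E(G).Finite)
    (hH : ∀ G', ¬ G.RestrictedBicontraction G')
    (h4 : G.IsMinimalBipartiteMatchingCovered → V(G).ncard ≠ 4) :
    G.IsTwoEdgeExtremal ↔ G.IsTwoVertexExtremal := by
  refine and_congr_right fun hG => ?_
  have hVf := hV.subset (fun _ hx => hx.1 : G.twoVertices ⊆ V(G))
  have hEf := hE.subset (fun _ hx => hx.1 : G.twoEdges ⊆ E(G))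
  have hsum := hG.bipartite.two_mul_ncard_twoEdges hV hE
  have hlow := hG.two_mul_le_ncard_twoVertices hV hE
  have hone : ∀ x ∈ hVf.toFinset, 1 ≤ {e ∈ G.twoEdges | G.Inc e x}.ncard := by
    intro x hx
    rw [Set.Finite.mem_toFinset] at hx
    obtain ⟨e, he, hi⟩ := hG.exists_mem_twoEdges hV hE hH hx
    exact (Set.ncard_pos (hEf.subset (Set.sep_subset _ _))).2 ⟨e, he, hi⟩
  have hVc := Set.ncard_eq_toFinset_card _ hVf
  constructor
  · intro hext
    have hle := Finset.card_nsmul_le_sum _ _ _ hone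
    rw [hsum, smul_eq_mul, mul_one, ← hVc] at hle
    omega
  · intro hext
    have heq : ∀ x ∈ hVf.toFinset, {e ∈ G.twoEdges | G.Inc e x}.ncard = 1 := by
      intro x hx
      refine le_antisymm ?_ (hone x hx)
      rw [Set.Finite.mem_toFinset] at hx
      rw [Set.ncard_le_one (hEf.subset (Set.sep_subset _ _))]
      rintro e₁ ⟨he₁, v₁, hl₁⟩ e₂ ⟨he₂, v₂, hl₂⟩
      by_contra hne
      have hbc := hG.isBicontractible hV hE hl₁ hl₂ hne hx.2
      have hd₁ := he₁.2 _ hl₁.inc_right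
      have hd₂ := he₂.2 _ hl₂.inc_right
      -- The order is even, at least 4 and not 4, so the contraction still has four vertices.
      have h6 : 6 ≤ V(G).ncard := by
        obtain ⟨k, hk⟩ := hG.even_ncard hV
        have := hG.matchingCovered.four_le
        have := h4 hG
        omega
      have hG' := hbc.isMinimal_contractPair_of_degree_eq_two hG hV hE hd₁ hd₂ h6
      have hV' : V(G.contractPair x v₁ v₂ e₁ e₂).Finite := by
        rw [hbc.vertexSet_contractPair]
        exact hV.sdiff
      have hE' : E(G.contractPair x v₁ v₂ e₁ e₂).Finite := by
        rw [edgeSet_contractPair]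
        exact hE.sdiff
      -- The contraction keeps m - n but has two fewer vertices of degree 2, one pair short of the
      -- lower bound.
      have h1 := hG'.two_mul_le_ncard_twoVertices hV' hE'
      have h2 := hbc.ncard_vertexSet hV
      have h3 := hbc.ncard_edgeSet hE
      have h5 := hbc.ncard_twoVertices_contractPair_of_degree_eq_two hG.bipartite hV hE hx.2 hd₁ hd₂
      omega
    rw [Finset.sum_congr rfl heq, Finset.sum_const, smul_eq_mul, mul_one, ← hVc] at hsum
    omega

/-! ### Invariance along restricted bicontractions, and the conclusion -/

namespace RestrictedBicontraction

variable {G' : Graph α β}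

theorem finite_vertexSet (h : G.RestrictedBicontraction G') (hV : V(G).Finite) :
    V(G').Finite := by
  obtain ⟨v, v₁, v₂, e₁, e₂, -, -, -, -, -, -, rfl⟩ := h
  exact hV.image _

theorem finite_edgeSet (h : G.RestrictedBicontraction G') (hE : E(G).Finite) :
    E(G').Finite := by
  obtain ⟨v, v₁, v₂, e₁, e₂, -, -, -, -, -, -, rfl⟩ := h
  rw [edgeSet_contractPair]
  exact hE.sdiff

theorem ncard_vertexSet_lt (h : G.RestrictedBicontraction G') (hV : V(G).Finite)
    (hE : E(G).Finite) : V(G').ncard < V(G).ncard := by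
  obtain ⟨v, v₁, v₂, e₁, e₂, hbc, -, -, rfl⟩ := h.exists_isBicontractible hE
  have := hbc.ncard_vertexSet hV
  omega

theorem isTwoEdgeExtremal_iff (h : G.RestrictedBicontraction G') (hV : V(G).Finite)
    (hE : E(G).Finite) : G.IsTwoEdgeExtremal ↔ G'.IsTwoEdgeExtremal := by
  obtain ⟨v, v₁, v₂, e₁, e₂, hbc, h₁, h₂, rfl⟩ := h.exists_isBicontractible hE
  rw [IsTwoEdgeExtremal, IsTwoEdgeExtremal, hbc.isMinimal_iff_of_three_le_degree hV h₁ h₂]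
  refine and_congr_right fun hG => ?_
  rw [hbc.twoEdges_contractPair hG.bipartite hE h₁ h₂]
  have := hbc.ncard_vertexSet hV
  have := hbc.ncard_edgeSet hE
  omega

/-- The merged vertex has degree at least 3 + 3 - 2 = 4, while a degree is at most half the order.
-/
theorem ncard_vertexSet_ne_four (h : G.RestrictedBicontraction G') (hV : V(G).Finite)
    (hE : E(G).Finite) (hG' : G'.IsMinimalBipartiteMatchingCovered) : V(G').ncard ≠ 4 := by
  have hV' := h.finite_vertexSet hV
  obtain ⟨v, v₁, v₂, e₁, e₂, hbc, h₁, h₂, rfl⟩ := h.exists_isBicontractible hE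
  have hG := (hbc.isMinimal_iff_of_three_le_degree hV h₁ h₂).1 hG'
  have hd := hbc.degree_contractPair_self hG.bipartite hE
  have := hG'.two_mul_degree_le hV' (x := v) (by
    rw [hbc.vertexSet_contractPair]
    exact ⟨hbc.link₁.left_mem, by simp [hbc.ne₁, hbc.ne₂]⟩)
  omega

end RestrictedBicontraction

theorem exists_isPartialRetract (hV : V(G).Finite) (hE : E(G).Finite) :
    ∃ H, G.IsPartialRetract H := by
  induction hn : V(G).ncard using Nat.strong_induction_on generalizing G with
  | _ n ih =>
    by_cases hG : ∃ G', G.RestrictedBicontraction G'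
    · obtain ⟨G', hG'⟩ := hG
      obtain ⟨H, hH, hmax⟩ := ih _ (hn ▸ hG'.ncard_vertexSet_lt hV hE)
        (hG'.finite_vertexSet hV) (hG'.finite_edgeSet hE) rfl
      exact ⟨H, hH.head hG', hmax⟩
    · exact ⟨G, .refl, fun G' hG' => hG ⟨G', hG'⟩⟩

theorem reflTransGen_restrictedBicontraction {H : Graph α β}
    (h : Relation.ReflTransGen RestrictedBicontraction G H) (hV : V(G).Finite)
    (hE : E(G).Finite) :
    V(H).Finite ∧ E(H).Finite ∧ (G.IsTwoEdgeExtremal ↔ H.IsTwoEdgeExtremal) := by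
  induction h with
  | refl => exact ⟨hV, hE, Iff.rfl⟩
  | tail _ hbc ih =>
    obtain ⟨hV', hE', hiff⟩ := ih
    exact ⟨hbc.finite_vertexSet hV', hbc.finite_edgeSet hE',
      hiff.trans (hbc.isTwoEdgeExtremal_iff hV' hE')⟩

end Graph

theorem theorem1p7 {α β : Type*} (G : Graph α β) [G.Loopless]
    (hV : G.vertexSet.Finite) (hE : G.edgeSet.Finite)
    (hC : ¬ G.IsIsomorphic Graph.cycleFour) :
    (∃ H, G.IsPartialRetract H) ∧
      ∀ H, G.IsPartialRetract H → (G.IsTwoEdgeExtremal ↔ H.IsTwoVertexExtremal) := by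
  refine ⟨Graph.exists_isPartialRetract hV hE, fun H ⟨hGH, hmax⟩ => ?_⟩
  obtain ⟨hVH, hEH, hiff⟩ := Graph.reflTransGen_restrictedBicontraction hGH hV hE
  rw [hiff]
  refine Graph.isTwoEdgeExtremal_iff_isTwoVertexExtremal hVH hEH hmax fun hH => ?_
  -- A minimal partial retract of order four would be `G` itself, hence excluded as C₄, or the
  -- result of a last contraction, which never has order four when minimal.
  rcases hGH.cases_tail with rfl | ⟨K, hGK, hKH⟩
  · exact fun h4 => hC (hH.isIsomorphic_cycleFour hV h4)
  · obtain ⟨hVK, hEK, -⟩ := Graph.reflTransGen_restrictedBicontraction hGK hV hE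
    exact hKH.ncard_vertexSet_ne_four hVK hEK hH
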